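/- **Approximate Eastin-Knill theorem.** Let $L$ be a quantum system of finite dimension $d_L\ge 1$, let $P=P_1\cdots P_n$ be a quantum system composed of $n$ finite-dimensional subsystems, and let $\mathcal E:\mathcal B(L)\to\mathcal B(P)$ be a code, i.e. a completely positive trace-preserving (CPTP) map. Suppose that the code admits a transversal implementation of the full unitary group: for every $U\in U(d_L)$ there are unitaries $V_i$ on $P_i$, $i=1,\dots,n$, such that $$\mathcal E(U X U^\dagger)=(V_1\otimes\cdots\otimes V_n)\,\mathcal E(X)\,(V_1\otimes\cdots\otimes V_n)^\dagger\qquad\text{for all }X\in\mathcal B(L).$$ Let $\varepsilon\in\mathbb R$ and $c=\frac{d_L+1}{d_L}$. Then for every $j\in\{1,\dots,n\}$, with $P_{/j}$ the composite of all subsystems except $P_j$, the following are equivalent. 1. $\mathcal E$ is $\varepsilon$-correctable with respect to erasure of the $j$-th subsystem: there is a CPTP map $\mathcal D:\mathcal B(P_{/j})\to\mathcal B(L)$ such that $F\big(\mathcal D\circ\mathrm{tr}_{P_j}\circ\mathcal E(\psi),\psi\big)\ge 1-\varepsilon$ for all pure states $\psi$ of $L$, where $F(\rho,\sigma)=\big(\mathrm{tr}\sqrt{\sqrt\rho\,\sigma\sqrt\rho}\big)^2$.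 2. $H_{\min}(L|P_{/j})_{J(\mathrm{tr}_{P_j}\circ\mathcal E)}\le-\log\big[d_L(1-c\,\varepsilon)\big]$. More generally, for every set $S$ of $m<n$ of the subsystems, the same equivalence holds with $\mathrm{tr}_{P_j}$ replaced by the partial trace over the subsystems in $S$ and $P_{/j}$ replaced by the composite of the remaining subsystems. Here $J(\Phi)=d_L^{-1}\sum_{i,k}|i\rangle\langle k|\otimes\Phi(|i\rangle\langle k|)$ is the Choi state of a channel $\Phi$ on $\mathcal B(L)$, $H_{\min}(A|B)_\Omega=-\log\inf\{\mathrm{tr}\,X : X\in\mathcal B(B),\ X\ge 0,\ \mathbb 1_A\otimes X-\Omega\ge 0\}$ is the conditional min-entropy, logarithms are to base $2$, and $-\log x:=+\infty$ for $x\le 0$. -/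

import Mathlib

open scoped Kronecker ComplexOrder

noncomputable section

namespace QCode

/-! A finite-dimensional quantum system is given by a finite index type of an orthonormal basis of
its Hilbert space; operators on it are complex matrices, and maps between operator spaces are
`ℂ`-linear maps of matrices. -/

/-- The map `id_R ⊗ Φ` on operators of the composite system `R A`. -/
def idTensor (R : Type*) {A B : Type*}
    (Φ : Matrix A A ℂ →ₗ[ℂ] Matrix B B ℂ) :
    Matrix (R × A) (R × A) ℂ →ₗ[ℂ] Matrix (R × B) (R × B) ℂ where
  toFun M := Matrix.of fun x y =>
    Φ (Matrix.of fun a a' => M (x.1, a) (y.1, a')) x.2 y.2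
  map_add' M N := by
    ext x y
    have h : (Matrix.of fun a a' => (M + N) (x.1, a) (y.1, a'))
        = (Matrix.of fun a a' => M (x.1, a) (y.1, a'))
          + (Matrix.of fun a a' => N (x.1, a) (y.1, a')) := rfl
    simp only [Matrix.of_apply, Matrix.add_apply]
    exact (congrArg (fun Z => Φ Z x.2 y.2) h).trans (by rw [map_add]; rfl)
  map_smul' c M := by
    ext x y
    have h : (Matrix.of fun a a' => (c • M) (x.1, a) (y.1, a'))
        = c • (Matrix.of fun a a' => M (x.1, a) (y.1, a')) := rfl
    simp only [Matrix.of_apply, Matrix.smul_apply, RingHom.id_apply]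
    exact (congrArg (fun Z => Φ Z x.2 y.2) h).trans (by rw [map_smul]; rfl)

/-- Complete positivity: `id_k ⊗ Φ` preserves positive semidefiniteness for every `k`. -/
def IsCompletelyPositive {A B : Type*} [Fintype A] [Fintype B]
    (Φ : Matrix A A ℂ →ₗ[ℂ] Matrix B B ℂ) : Prop :=
  ∀ (k : ℕ) (M : Matrix (Fin k × A) (Fin k × A) ℂ),
    M.PosSemidef → (idTensor (Fin k) Φ M).PosSemidef

/-- A quantum channel: a completely positive, trace-preserving linear map. -/
structure IsChannel {A B : Type*} [Fintype A] [Fintype B]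
    (Φ : Matrix A A ℂ →ₗ[ℂ] Matrix B B ℂ) : Prop where
  completelyPositive : IsCompletelyPositive Φ
  tracePreserving : ∀ X : Matrix A A ℂ, (Φ X).trace = X.trace

/-- Pure states `|v⟩⟨v|`, with `v` a unit vector. -/
def IsPure {A : Type*} [Fintype A] (ψ : Matrix A A ℂ) : Prop :=
  ∃ v : A → ℂ, star v ⬝ᵥ v = 1 ∧ ψ = Matrix.vecMulVec v (star v)

open scoped MatrixOrder in
/-- The fidelity `F(ρ, σ) = (tr √(√ρ σ √ρ))²`. -/
def fidelity {A : Type*} [Fintype A] [DecidableEq A] (ρ σ : Matrix A A ℂ) : ℝ :=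
  (CFC.sqrt (CFC.sqrt ρ * σ * CFC.sqrt ρ)).trace.re ^ 2

/-- The code `E` is `ε`-correctable under the noise `N`: some recovery channel restores every pure
logical state up to infidelity `ε`. -/
def IsCorrectable {L P P' : Type*} [Fintype L] [DecidableEq L] [Fintype P']
    (E : Matrix L L ℂ →ₗ[ℂ] Matrix P P ℂ) (N : Matrix P P ℂ →ₗ[ℂ] Matrix P' P' ℂ)
    (ε : ℝ) : Prop :=
  ∃ D : Matrix P' P' ℂ →ₗ[ℂ] Matrix L L ℂ, IsChannel D ∧
    ∀ ψ : Matrix L L ℂ, IsPure ψ → 1 - ε ≤ fidelity (D (N (E ψ))) ψ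

/-- The tensor product `⨂ᵢ Vᵢ` of operators on the subsystems. -/
def piTensor {n : ℕ} {P : Fin n → Type*} (V : ∀ i, Matrix (P i) (P i) ℂ) :
    Matrix (∀ i, P i) (∀ i, P i) ℂ :=
  Matrix.of fun a b => ∏ i, V i (a i) (b i)

/-- The logical gate `U` can be implemented transversally in the code `E`: there are unitaries
`Vᵢ` on the subsystems with `E ∘ Ad U = Ad (⨂ᵢ Vᵢ) ∘ E`. -/
def IsTransversalGate {n : ℕ} {L : Type*} {P : Fin n → Type*}
    [Fintype L] [∀ i, Fintype (P i)] [∀ i, DecidableEq (P i)]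
    (E : Matrix L L ℂ →ₗ[ℂ] Matrix (∀ i, P i) (∀ i, P i) ℂ) (U : Matrix L L ℂ) : Prop :=
  ∃ V : ∀ i, Matrix (P i) (P i) ℂ, (∀ i, V i ∈ Matrix.unitaryGroup (P i) ℂ) ∧
    ∀ X : Matrix L L ℂ,
      E (U * X * U.conjTranspose) = piTensor V * E X * (piTensor V).conjTranspose

/-- Erasure of the subsystems in `S`: the partial trace over `⨂_{i ∈ S} Pᵢ`, with values in the
operators on the remaining subsystems. -/
def erasure {n : ℕ} {P : Fin n → Type*} [∀ i, Fintype (P i)] (S : Finset (Fin n)) :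
    Matrix (∀ i, P i) (∀ i, P i) ℂ →ₗ[ℂ]
      Matrix (∀ i : {i // ¬ i ∈ S}, P i) (∀ i : {i // ¬ i ∈ S}, P i) ℂ where
  toFun M := Matrix.of fun a b => ∑ e : (∀ i : {i // i ∈ S}, P i),
    M ((Equiv.piEquivPiSubtypeProd (fun i => i ∈ S) P).symm (e, a))
      ((Equiv.piEquivPiSubtypeProd (fun i => i ∈ S) P).symm (e, b))
  map_add' M N := by
    ext a b
    simp only [Matrix.of_apply, Matrix.add_apply, Finset.sum_add_distrib]
  map_smul' c M := by
    ext a b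
    simp only [Matrix.of_apply, Matrix.smul_apply, Finset.smul_sum, RingHom.id_apply]

/-- The Choi state `J(Φ) = d_L⁻¹ (id_L ⊗ Φ) (∑ᵢⱼ |ii⟩⟨jj|)`. -/
def choiState {L B : Type*} [Fintype L] [DecidableEq L]
    (Φ : Matrix L L ℂ →ₗ[ℂ] Matrix B B ℂ) : Matrix (L × B) (L × B) ℂ :=
  (Fintype.card L : ℂ)⁻¹ •
    idTensor L Φ (∑ i : L, ∑ j : L, Matrix.single (i, i) (j, j) (1 : ℂ))

/-- Binary logarithm with `log x = -∞` for `x ≤ 0`. -/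
def log₂ (x : ℝ) : EReal :=
  if 0 < x then ((Real.logb 2 x : ℝ) : EReal) else ⊥

/-- The conditional min-entropy
`H_min(A|B)_Ω = - log inf {tr X | X ≥ 0, 1_A ⊗ X - Ω ≥ 0}`. -/
def condMinEntropy {A B : Type*} [Fintype A] [DecidableEq A] [Fintype B]
    (Ω : Matrix (A × B) (A × B) ℂ) : EReal :=
  - log₂ (sInf {t : ℝ | ∃ X : Matrix B B ℂ, X.PosSemidef ∧
      ((1 : Matrix A A ℂ) ⊗ₖ X - Ω).PosSemidef ∧ t = X.trace.re})

end QCode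

end

open scoped Kronecker ComplexOrder

namespace QCode

/-! ### Choi matrices, complete positivity and channels -/

section Choi

variable {A B C R L Q : Type*}

/-! Let `N` be the code followed by the erasure and `d` the dimension of `L`. The partial trace
absorbs the gates on erased subsystems, so `N ∘ Ad U = Ad V ∘ N` with `V` the product of the
remaining gates (`erasure_piTensor_conj`).

For a recovery `D` with Choi matrix `Y`, the pairing of `Y` with the Choi state of `N` is `d` times
the entanglement fidelity of `D ∘ N`. Its maximum over channels is a semidefinite program whose dual
value is the infimum defining the min-entropy (`exists_dual_lt`, `pairing_le_of_dual_feasible`). The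
entropy condition thus says that some channel reaches pairing at least `d (1 - c ε)`.

Correctability concerns the worst-case fidelity instead. By covariance, `D` may be chosen with `D ∘
N` commuting with all unitary conjugations (`exists_covariant`). The fidelity is then a constant `F`
on pure states, and `card_add_trace_superMatrix` gives `1 + pairing = F (d + 1)`. Hence `F ≥ 1 - ε`
is the same as pairing at least `d (1 - c ε)`.

No Haar integral is used: twirling minimises a strictly convex norm over a compact set, and
averaging over states becomes a sum over four phases. -/

theorem idTensor_apply (Φ : Matrix A A ℂ →ₗ[ℂ] Matrix B B ℂ) (M : Matrix (R × A) (R × A) ℂ)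
    (x y : R × B) :
    idTensor R Φ M x y = Φ (Matrix.of fun a a' => M (x.1, a) (y.1, a')) x.2 y.2 := rfl

theorem IsCompletelyPositive.posSemidef_idTensor [Fintype A] [Fintype B] [Fintype R]
    {Φ : Matrix A A ℂ →ₗ[ℂ] Matrix B B ℂ} (h : IsCompletelyPositive Φ)
    {M : Matrix (R × A) (R × A) ℂ} (hM : M.PosSemidef) : (idTensor R Φ M).PosSemidef := by
  classical
  let e := Fintype.equivFin R
  exact (h _ _ (hM.submatrix (Prod.map e.symm id))).submatrix (Prod.map e id) |> fun h => by
    convert h using 1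
    ext x y
    simp [idTensor_apply, e]

theorem IsCompletelyPositive.posSemidef_apply [Fintype A] [Fintype B]
    {Φ : Matrix A A ℂ →ₗ[ℂ] Matrix B B ℂ} (h : IsCompletelyPositive Φ)
    {M : Matrix A A ℂ} (hM : M.PosSemidef) : (Φ M).PosSemidef :=
  (h.posSemidef_idTensor (R := Unit) (hM.submatrix Prod.snd)).submatrix (fun b => ((), b))

theorem IsCompletelyPositive.comp [Fintype A] [Fintype B] [Fintype C]
    {Ψ : Matrix B B ℂ →ₗ[ℂ] Matrix C C ℂ} {Φ : Matrix A A ℂ →ₗ[ℂ] Matrix B B ℂ}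
    (hΨ : IsCompletelyPositive Ψ) (hΦ : IsCompletelyPositive Φ) :
    IsCompletelyPositive (Ψ ∘ₗ Φ) :=
  fun k M hM => hΨ k _ (hΦ k M hM)

theorem IsChannel.comp [Fintype A] [Fintype B] [Fintype C]
    {Ψ : Matrix B B ℂ →ₗ[ℂ] Matrix C C ℂ} {Φ : Matrix A A ℂ →ₗ[ℂ] Matrix B B ℂ}
    (hΨ : IsChannel Ψ) (hΦ : IsChannel Φ) : IsChannel (Ψ ∘ₗ Φ) :=
  ⟨hΨ.1.comp hΦ.1, fun X => (hΨ.2 _).trans (hΦ.2 X)⟩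

theorem sum_sum_ite_eq {M : Type*} [AddCommMonoid M] [Fintype A] [Fintype B] [DecidableEq A]
    (x : A) (f : A → B → M) : (∑ i, ∑ j, if i = x then f i j else 0) = ∑ j, f x j := by
  rw [Finset.sum_comm]
  simp

/-- Summing the blocks of a positive semidefinite matrix gives a positive semidefinite matrix. -/
theorem posSemidef_sum_blocks [Fintype A] [Fintype Q] {W : Matrix (A × Q) (A × Q) ℂ}
    (hW : W.PosSemidef) :
    (Matrix.of fun x y => ∑ q, ∑ q', W (x, q) (y, q')).PosSemidef := by
  classical
  -- The block sum is a congruence of `W` by the 0/1 matrix that forgets the `Q` index.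
  convert hW.conjTranspose_mul_mul_same (Matrix.of fun (p : A × Q) y => if p.1 = y then (1 : ℂ) else 0)
    using 1
  ext x y
  simp only [Matrix.mul_apply, Fintype.sum_prod_type, Matrix.conjTranspose_apply, Matrix.of_apply,
    apply_ite star, star_one, star_zero, ite_mul, mul_ite, one_mul, zero_mul, mul_one, mul_zero,
    sum_sum_ite_eq]
  rw [Finset.sum_comm]

/-- The entrywise pairing `∑ M_{xy} Y_{xy}` of two matrices. -/
def pairing [Fintype A] (M Y : Matrix A A ℂ) : ℂ := ∑ x, ∑ y, M x y * Y x y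

theorem pairing_sub_left [Fintype A] (M M' Y : Matrix A A ℂ) :
    pairing (M - M') Y = pairing M Y - pairing M' Y := by
  simp [pairing, sub_mul, Finset.sum_sub_distrib]

/-- The pairing is `tr (M Yᵀ)`. It sums all entries of the Hadamard product, which is a principal
submatrix of `M ⊗ₖ Y` and so positive semidefinite. -/
theorem pairing_nonneg [Fintype A] {M Y : Matrix A A ℂ} (hM : M.PosSemidef) (hY : Y.PosSemidef) :
    0 ≤ pairing M Y := by
  classical
  have h := posSemidef_sum_blocks (A := Unit) (((hM.kronecker hY).submatrix
    (fun x : A => (x, x))).submatrix (Prod.snd : Unit × A → A))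
  simpa [pairing] using h.diag_nonneg (i := ())

/-- The linear map with a given Choi matrix. -/
def choiMap [Fintype Q] (Y : Matrix (L × Q) (L × Q) ℂ) : Matrix Q Q ℂ →ₗ[ℂ] Matrix L L ℂ where
  toFun Z := Matrix.of fun a b => ∑ q, ∑ q', Z q q' * Y (a, q) (b, q')
  map_add' Z Z' := by
    ext a b
    simp [add_mul, Finset.sum_add_distrib]
  map_smul' c Z := by
    ext a b
    simp [Finset.mul_sum, mul_assoc]

theorem choiMap_apply [Fintype Q] (Y : Matrix (L × Q) (L × Q) ℂ) (Z : Matrix Q Q ℂ) (a b : L) :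
    choiMap Y Z a b = ∑ q, ∑ q', Z q q' * Y (a, q) (b, q') := rfl

/-- The (unnormalized) Choi matrix of a linear map. -/
def choiMatrix [DecidableEq Q] (D : Matrix Q Q ℂ →ₗ[ℂ] Matrix L L ℂ) :
    Matrix (L × Q) (L × Q) ℂ :=
  Matrix.of fun x y => D (Matrix.single x.2 y.2 1) x.1 y.1

theorem map_apply_eq_sum [Fintype Q] [DecidableEq Q] (D : Matrix Q Q ℂ →ₗ[ℂ] Matrix L L ℂ)
    (Z : Matrix Q Q ℂ) (a b : L) :
    D Z a b = ∑ q, ∑ q', Z q q' * D (Matrix.single q q' 1) a b := by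
  conv_lhs => rw [Matrix.matrix_eq_sum_single Z]
  simp only [map_sum, Matrix.sum_apply]
  refine Finset.sum_congr rfl fun q _ => Finset.sum_congr rfl fun q' _ => ?_
  have : Matrix.single q q' (Z q q') = Z q q' • Matrix.single q q' (1 : ℂ) := by simp
  rw [this, map_smul, Matrix.smul_apply, smul_eq_mul]

theorem choiMap_choiMatrix [Fintype Q] [DecidableEq Q] (D : Matrix Q Q ℂ →ₗ[ℂ] Matrix L L ℂ) :
    choiMap (choiMatrix D) = D := by
  refine LinearMap.ext fun Z => Matrix.ext fun a b => ?_
  rw [choiMap_apply, map_apply_eq_sum D Z]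
  rfl

theorem posSemidef_maxEntangled [Fintype Q] [DecidableEq Q] :
    (∑ i : Q, ∑ j : Q, Matrix.single (i, i) (j, j) (1 : ℂ)).PosSemidef := by
  convert Matrix.posSemidef_vecMulVec_self_star (fun x : Q × Q => if x.1 = x.2 then (1 : ℂ) else 0)
    using 1
  ext ⟨a, b⟩ ⟨c, d⟩
  simp only [Matrix.sum_apply, Matrix.single_apply, Matrix.vecMulVec_apply, Prod.mk.injEq,
    Pi.star_apply]
  rw [Finset.sum_eq_single a (by intro i _ hi; simp [hi]) (by simp),
    Finset.sum_eq_single c (by intro i _ hi; simp [hi]) (by simp)]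
  split_ifs <;> simp_all

theorem idTensor_maxEntangled [Fintype Q] [DecidableEq Q] (D : Matrix Q Q ℂ →ₗ[ℂ] Matrix L L ℂ)
    (x y : Q × L) :
    idTensor Q D (∑ i : Q, ∑ j : Q, Matrix.single (i, i) (j, j) (1 : ℂ)) x y
      = D (Matrix.single x.1 y.1 1) x.2 y.2 := by
  rw [idTensor_apply]
  refine congrArg (fun Z => D Z x.2 y.2) (Matrix.ext fun a b => ?_)
  simp only [Matrix.sum_apply, Matrix.single_apply, Prod.mk.injEq, Matrix.of_apply]
  rw [Finset.sum_eq_single x.1 (by intro i _ hi; simp [hi]) (by simp),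
    Finset.sum_eq_single y.1 (by intro i _ hi; simp [hi]) (by simp)]
  simp

theorem IsCompletelyPositive.posSemidef_choiMatrix [Fintype Q] [DecidableEq Q] [Fintype L]
    {D : Matrix Q Q ℂ →ₗ[ℂ] Matrix L L ℂ} (hD : IsCompletelyPositive D) :
    (choiMatrix D).PosSemidef := by
  convert (hD.posSemidef_idTensor posSemidef_maxEntangled).submatrix (Prod.swap : L × Q → Q × L)
    using 1
  ext x y
  rw [Matrix.submatrix_apply, idTensor_maxEntangled]
  rfl

/-- Applying `id ⊗ choiMap Y` to `M` restricts `M ⊗ₖ Y` to equal `Q` indices and then sums the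
blocks; both operations preserve positivity. -/
theorem isCompletelyPositive_choiMap [Fintype Q] [Fintype L] {Y : Matrix (L × Q) (L × Q) ℂ}
    (hY : Y.PosSemidef) : IsCompletelyPositive (choiMap Y) := by
  intro k M hM
  convert posSemidef_sum_blocks ((hM.kronecker hY).submatrix
    (fun x : (Fin k × L) × Q => ((x.1.1, x.2), (x.1.2, x.2)))) using 1
  ext x y
  simp [idTensor_apply, choiMap_apply]

/-- The Choi matrices of quantum channels. -/
def channelChoi (L Q : Type*) [Fintype L] [DecidableEq Q] : Set (Matrix (L × Q) (L × Q) ℂ) :=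
  {Y | Y.PosSemidef ∧ ∀ q q', ∑ a, Y (a, q) (a, q') = if q = q' then 1 else 0}

theorem isChannel_choiMap [Fintype Q] [DecidableEq Q] [Fintype L] {Y : Matrix (L × Q) (L × Q) ℂ}
    (hY : Y ∈ channelChoi L Q) : IsChannel (choiMap Y) := by
  refine ⟨isCompletelyPositive_choiMap hY.1, fun Z => ?_⟩
  simp only [Matrix.trace, Matrix.diag_apply, choiMap_apply]
  rw [Finset.sum_comm]
  refine Finset.sum_congr rfl fun q _ => ?_
  rw [Finset.sum_comm]
  refine (Finset.sum_congr rfl fun q' _ => (Finset.mul_sum _ _ _).symm).trans ?_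
  simp [hY.2]

theorem IsChannel.choiMatrix_mem [Fintype Q] [DecidableEq Q] [Fintype L]
    {D : Matrix Q Q ℂ →ₗ[ℂ] Matrix L L ℂ} (hD : IsChannel D) :
    choiMatrix D ∈ channelChoi L Q := by
  refine ⟨hD.1.posSemidef_choiMatrix, fun q q' => ?_⟩
  refine (hD.2 (Matrix.single q q' 1)).trans ?_
  split_ifs with h
  · subst h; simp
  · simp [h]

/-- The conjugation `X ↦ U X U†`. -/
def conjMap [Fintype A] (U : Matrix B A ℂ) : Matrix A A ℂ →ₗ[ℂ] Matrix B B ℂ where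
  toFun X := U * X * U.conjTranspose
  map_add' X Y := by rw [Matrix.mul_add, Matrix.add_mul]
  map_smul' c X := by rw [RingHom.id_apply, Matrix.mul_smul, Matrix.smul_mul]

theorem conjMap_apply [Fintype A] (U : Matrix B A ℂ) (X : Matrix A A ℂ) :
    conjMap U X = U * X * U.conjTranspose := rfl

theorem isCompletelyPositive_conjMap [Fintype A] [Fintype B] (U : Matrix B A ℂ) :
    IsCompletelyPositive (conjMap U) := by
  classical
  intro k M hM
  convert hM.mul_mul_conjTranspose_same ((1 : Matrix (Fin k) (Fin k) ℂ) ⊗ₖ U) using 1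
  ext x y
  simp [idTensor_apply, conjMap_apply, Matrix.mul_apply, Fintype.sum_prod_type, Matrix.one_apply,
    apply_ite, Finset.sum_ite_irrel, ite_mul]

theorem isChannel_conjMap [Fintype A] [DecidableEq A] {U : Matrix A A ℂ}
    (hU : U ∈ Matrix.unitaryGroup A ℂ) : IsChannel (conjMap U) := by
  refine ⟨isCompletelyPositive_conjMap U, fun X => ?_⟩
  rw [conjMap_apply, Matrix.trace_mul_comm, ← mul_assoc, ← Matrix.star_eq_conjTranspose,
    Matrix.mem_unitaryGroup_iff'.1 hU, one_mul]

end Choi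

/-! ### Semidefinite duality for the optimal recovery -/

section Duality

variable {A L Q : Type*}

/-- The pairing carries a transpose, so the rank-one test matrix has the conjugation on its first
factor. -/
theorem pairing_conj_vec [Fintype A] (M : Matrix A A ℂ) (w : A → ℂ) :
    pairing M (Matrix.vecMulVec (star w) w) = star w ⬝ᵥ M.mulVec w := by
  simp only [pairing, dotProduct, Matrix.mulVec, Matrix.vecMulVec_apply, Finset.mul_sum]
  refine Finset.sum_congr rfl fun x _ => Finset.sum_congr rfl fun y _ => ?_
  ring

theorem pairing_smul_right [Fintype A] (M Y : Matrix A A ℂ) (c : ℂ) :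
    pairing M (c • Y) = c * pairing M Y := by
  simp only [pairing, Finset.mul_sum, Matrix.smul_apply, smul_eq_mul]
  refine Finset.sum_congr rfl fun x _ => Finset.sum_congr rfl fun y _ => ?_
  ring

theorem pairing_smul_left [Fintype A] (M Y : Matrix A A ℂ) (c : ℂ) :
    pairing (c • M) Y = c * pairing M Y := by
  simp only [pairing, Finset.mul_sum, Matrix.smul_apply, smul_eq_mul, mul_assoc]

theorem pairing_add_left [Fintype A] (M M' Y : Matrix A A ℂ) :
    pairing (M + M') Y = pairing M Y + pairing M' Y := by
  simp [pairing, add_mul, Finset.sum_add_distrib]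

theorem pairing_add_right [Fintype A] (M Y Y' : Matrix A A ℂ) :
    pairing M (Y + Y') = pairing M Y + pairing M Y' := by
  simp [pairing, mul_add, Finset.sum_add_distrib]

theorem pairing_one_left [Fintype A] [DecidableEq A] (Y : Matrix A A ℂ) :
    pairing 1 Y = Y.trace := by
  simp [pairing, Matrix.one_apply, Matrix.trace]

theorem pairing_one_right [Fintype A] [DecidableEq A] (Y : Matrix A A ℂ) :
    pairing Y 1 = Y.trace := by
  simp [pairing, Matrix.one_apply, Matrix.trace]

theorem pairing_conjTranspose [Fintype A] (M Y : Matrix A A ℂ) :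
    pairing M.conjTranspose Y.conjTranspose = star (pairing M Y) := by
  simp only [pairing, Matrix.conjTranspose_apply, star_sum, star_mul']
  rw [Finset.sum_comm]

theorem continuous_pairing [Fintype A] (M : Matrix A A ℂ) : Continuous (pairing M) := by
  unfold pairing
  fun_prop

/-- Rank-one matrices rescaled to trace `m` already detect positivity. The fixed trace matches the
compact set used in the separation argument. -/
theorem posSemidef_of_pairing_nonneg [Fintype A] [DecidableEq A] {M : Matrix A A ℂ}
    (hM : M.IsHermitian) {m : ℝ} (hm : 0 < m)
    (h : ∀ Y : Matrix A A ℂ, Y.PosSemidef → Y.trace = m → 0 ≤ (pairing M Y).re) :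
    M.PosSemidef := by
  refine Matrix.PosSemidef.of_dotProduct_mulVec_nonneg hM fun w => ?_
  have hreal : (star w ⬝ᵥ M.mulVec w).im = 0 := hM.im_star_dotProduct_mulVec_self w
  rw [Complex.nonneg_iff]
  refine ⟨?_, hreal.symm⟩
  by_cases hw : w = 0
  · simp [hw]
  set Y := Matrix.vecMulVec (star w) w with hYdef
  have hY : Y.PosSemidef := Matrix.posSemidef_vecMulVec_star_self w
  have htr : 0 < Y.trace := by
    rw [hYdef, Matrix.trace_vecMulVec]
    exact Matrix.dotProduct_star_self_pos_iff.2 hw |> fun h => (dotProduct_comm w (star w)) ▸ h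
  obtain ⟨htr1, htr2⟩ := Complex.pos_iff.1 htr
  have htr' : Y.trace = (Y.trace.re : ℂ) := Complex.ext rfl (by simp [← htr2])
  have key := h (((m / Y.trace.re : ℝ) : ℂ) • Y)
    (hY.smul (by exact_mod_cast (div_pos hm htr1).le)) (by
      rw [Matrix.trace_smul, smul_eq_mul, htr']
      have : (Y.trace.re : ℂ) ≠ 0 := by exact_mod_cast htr1.ne'
      push_cast
      simp only [Complex.ofReal_re]
      field_simp)
  rw [pairing_smul_right, Complex.re_ofReal_mul, pairing_conj_vec] at key
  exact (mul_nonneg_iff_of_pos_left (div_pos hm htr1)).1 key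

/-- The partial trace over the first tensor factor. -/
def traceLeft [Fintype L] (Y : Matrix (L × Q) (L × Q) ℂ) : Matrix Q Q ℂ :=
  Matrix.of fun q q' => ∑ a, Y (a, q) (a, q')

theorem traceLeft_apply [Fintype L] (Y : Matrix (L × Q) (L × Q) ℂ) (q q' : Q) :
    traceLeft Y q q' = ∑ a, Y (a, q) (a, q') := rfl

theorem continuous_traceLeft [Fintype L] :
    Continuous (traceLeft : Matrix (L × Q) (L × Q) ℂ → Matrix Q Q ℂ) := by
  unfold traceLeft
  fun_prop

theorem trace_traceLeft [Fintype L] [Fintype Q] (Y : Matrix (L × Q) (L × Q) ℂ) :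
    (traceLeft Y).trace = Y.trace := by
  simp only [Matrix.trace, Matrix.diag_apply, traceLeft_apply, Fintype.sum_prod_type]
  rw [Finset.sum_comm]

theorem conjTranspose_traceLeft [Fintype L] (Y : Matrix (L × Q) (L × Q) ℂ) :
    (traceLeft Y).conjTranspose = traceLeft Y.conjTranspose := by
  ext q q'
  simp [traceLeft_apply]

theorem mem_channelChoi_iff [Fintype L] [DecidableEq Q] {Y : Matrix (L × Q) (L × Q) ℂ} :
    Y ∈ channelChoi L Q ↔ Y.PosSemidef ∧ traceLeft Y = 1 := by
  refine and_congr_right fun _ => ?_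
  rw [← Matrix.ext_iff]
  simp only [traceLeft_apply, Matrix.one_apply]

theorem pairing_one_kronecker [Fintype L] [DecidableEq L] [Fintype Q] (X : Matrix Q Q ℂ)
    (Y : Matrix (L × Q) (L × Q) ℂ) :
    pairing ((1 : Matrix L L ℂ) ⊗ₖ X) Y = pairing X (traceLeft Y) := by
  simp only [pairing, Fintype.sum_prod_type, Matrix.kroneckerMap_apply, Matrix.one_apply, ite_mul,
    one_mul, zero_mul, traceLeft_apply, Finset.mul_sum, Finset.sum_ite_irrel, Finset.sum_const_zero,
    Finset.sum_ite_eq, Finset.mem_univ, if_true]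
  rw [Finset.sum_comm]
  refine Finset.sum_congr rfl fun q _ => ?_
  rw [Finset.sum_comm]

open scoped MatrixOrder in
theorem exists_eq_conjTranspose_mul_self [Fintype A] [DecidableEq A] {Y : Matrix A A ℂ}
    (hY : Y.PosSemidef) : ∃ Z : Matrix A A ℂ, Y = Z.conjTranspose * Z := by
  have hs : (CFC.sqrt Y).PosSemidef := Matrix.nonneg_iff_posSemidef.1 (CFC.sqrt_nonneg Y)
  exact ⟨CFC.sqrt Y, by rw [hs.isHermitian.eq, CFC.sqrt_mul_sqrt_self Y hY.nonneg]⟩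

/-- The set is the image under `Z ↦ Zᴴ Z` of the Hilbert-Schmidt sphere of squared radius `m`. -/
theorem isCompact_posSemidef_trace (A : Type*) [Fintype A] (m : ℝ) :
    IsCompact {Y : Matrix A A ℂ | Y.PosSemidef ∧ Y.trace = m} := by
  classical
  have himage : {Y : Matrix A A ℂ | Y.PosSemidef ∧ Y.trace = m} =
      (fun Z : Matrix A A ℂ => Z.conjTranspose * Z) ''
        {Z | (Z.conjTranspose * Z).trace = m} := by
    ext Y
    constructor
    · rintro ⟨h1, h2⟩
      obtain ⟨Z, rfl⟩ := exists_eq_conjTranspose_mul_self h1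
      exact ⟨Z, h2, rfl⟩
    · rintro ⟨Z, hZ, rfl⟩
      exact ⟨Matrix.posSemidef_conjTranspose_mul_self Z, hZ⟩
  rw [himage]
  refine IsCompact.image ?_ (by fun_prop)
  -- The radius `m + 1` avoids a square root: `x ^ 2 ≤ m` gives `2 x ≤ m + 1`.
  refine IsCompact.of_isClosed_subset
    (isCompact_univ_pi fun _ : A => isCompact_univ_pi fun _ : A =>
      isCompact_closedBall (0 : ℂ) (m + 1)) (isClosed_eq (by fun_prop) continuous_const) ?_
  intro Z hZ i _ j _
  rw [mem_closedBall_zero_iff]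
  have h : ∑ j, ∑ i, ‖Z i j‖ ^ 2 = m := by
    have : ((∑ j, ∑ i, ‖Z i j‖ ^ 2 : ℝ) : ℂ) = m := by
      rw [← hZ.out]
      push_cast
      simp only [Matrix.trace, Matrix.diag_apply, Matrix.mul_apply, Matrix.conjTranspose_apply,
        ← Complex.conj_mul']
      rfl
    exact_mod_cast this
  have h' : ‖Z i j‖ ^ 2 ≤ m := by
    rw [← h]
    refine le_trans ?_ (Finset.single_le_sum (f := fun j => ∑ i, ‖Z i j‖ ^ 2)
      (fun _ _ => by positivity) (Finset.mem_univ j))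
    exact Finset.single_le_sum (f := fun i => ‖Z i j‖ ^ 2) (fun _ _ => by positivity)
      (Finset.mem_univ i)
  nlinarith [sq_nonneg (‖Z i j‖ - 1)]

theorem isCompact_channelChoi (L Q : Type*) [Fintype L] [Fintype Q] [DecidableEq Q] :
    IsCompact (channelChoi L Q) := by
  have : channelChoi L Q = {Y | Y.PosSemidef ∧ Y.trace = ((Fintype.card Q : ℝ) : ℂ)} ∩
      {Y | traceLeft Y = 1} := by
    ext Y
    rw [mem_channelChoi_iff, Set.mem_inter_iff, Set.mem_ofPred_eq, Set.mem_ofPred_eq]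
    refine ⟨fun h => ⟨⟨h.1, ?_⟩, h.2⟩, fun h => ⟨h.1.1, h.2⟩⟩
    rw [← trace_traceLeft, h.2]
    simp
  rw [this]
  exact (isCompact_posSemidef_trace _ _).inter_right
    (isClosed_eq continuous_traceLeft continuous_const)

/-- Reads a separating functional as a dual variable `X` together with a multiplier `t` for the
objective. -/
theorem clm_apply_eq_pairing [Fintype Q] [DecidableEq Q] (f : StrongDual ℂ ((Q → Q → ℂ) × ℂ)) :
    ∃ (X : Matrix Q Q ℂ) (t : ℂ), ∀ (M : Matrix Q Q ℂ) (z : ℂ), f (M, z) = pairing X M + t * z := by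
  refine ⟨Matrix.of fun i j => f (Matrix.single i j 1, 0), f (0, 1), fun M z => ?_⟩
  have h1 : ((M, z) : (Q → Q → ℂ) × ℂ) =
      LinearMap.inl ℂ (Q → Q → ℂ) ℂ M + z • ((0 : Q → Q → ℂ), (1 : ℂ)) := by
    refine Prod.ext ?_ ?_
    · change M = M + z • (0 : Matrix Q Q ℂ)
      simp
    · simp
  rw [h1, map_add, map_smul, smul_eq_mul, mul_comm z]
  congr 1
  let g : Matrix Q Q ℂ →ₗ[ℂ] ℂ := f.toLinearMap ∘ₗ LinearMap.inl ℂ (Q → Q → ℂ) ℂ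
  change g M = _
  conv_lhs => rw [Matrix.matrix_eq_sum_single M]
  simp only [map_sum, pairing]
  refine Finset.sum_congr rfl fun q _ => Finset.sum_congr rfl fun q' _ => ?_
  have : Matrix.single q q' (M q q') = M q q' • Matrix.single q q' (1 : ℂ) := by simp
  rw [this, map_smul, smul_eq_mul, mul_comm]
  rfl

/-- **Strong duality**: if no quantum channel reaches the value `f` in the pairing of its Choi
matrix with `Ω`, then the dual semidefinite program has a feasible point of value below `f`. -/
theorem exists_dual_lt [Fintype L] [DecidableEq L] [Nonempty L] [Fintype Q] [DecidableEq Q]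
    [Nonempty Q] {Ω : Matrix (L × Q) (L × Q) ℂ} (hΩ : Ω.PosSemidef) {f : ℝ}
    (hf : ∀ Y ∈ channelChoi L Q, (pairing Ω Y).re < f) :
    ∃ X : Matrix Q Q ℂ, X.PosSemidef ∧ ((1 : Matrix L L ℂ) ⊗ₖ X - Ω).PosSemidef ∧
      X.trace.re < f := by
  set m : ℝ := (Fintype.card Q : ℝ) with hm
  have hm0 : 0 < m := by rw [hm]; exact_mod_cast Fintype.card_pos
  set B : Set (Matrix (L × Q) (L × Q) ℂ) := {Y | Y.PosSemidef ∧ Y.trace = m} with hB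
  have hBconv : Convex ℝ B := by
    intro Y hY Y' hY' a b ha hb hab
    refine ⟨(hY.1.smul ha).add (hY'.1.smul hb), ?_⟩
    rw [Matrix.trace_add, Matrix.trace_smul, Matrix.trace_smul, hY.2, hY'.2, ← add_smul, hab,
      one_smul]
  -- `B` keeps only the trace of the channel constraint; the full constraint is recorded in the
  -- first coordinate of `φ`. A point of `φ '' B` on `ray` would be a channel of value at least `f`.
  let φ : Matrix (L × Q) (L × Q) ℂ → (Q → Q → ℂ) × ℂ := fun Y => (traceLeft Y, pairing Ω Y)
  have hφ : Continuous φ := continuous_traceLeft.prodMk (continuous_pairing Ω)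
  have hlin : IsLinearMap ℝ φ := by
    constructor
    · intro Y Y'
      refine Prod.ext (Matrix.ext fun q q' => ?_) (pairing_add_right _ _ _)
      change ∑ a, (Y + Y') (a, q) (a, q') = ∑ a, Y (a, q) (a, q') + ∑ a, Y' (a, q) (a, q')
      simp [Finset.sum_add_distrib]
    · intro c Y
      refine Prod.ext (Matrix.ext fun q q' => ?_) (pairing_smul_right Ω Y c)
      change ∑ a, (c • Y) (a, q) (a, q') = c • ∑ a, Y (a, q) (a, q')
      simp [Finset.mul_sum]
  let ray : Set ((Q → Q → ℂ) × ℂ) :=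
    {p | p.1 = (1 : Matrix Q Q ℂ) ∧ f ≤ p.2.re ∧ p.2.im = 0}
  have hray : Convex ℝ ray := by
    intro p hp p' hp' a b ha hb hab
    refine ⟨?_, ?_, ?_⟩
    · change a • p.1 + b • p'.1 = _
      rw [hp.1, hp'.1]
      exact Convex.combo_self hab _
    · simp only [Prod.snd_add, Prod.smul_snd, Complex.add_re, Complex.smul_re, smul_eq_mul]
      have h1 := mul_le_mul_of_nonneg_left hp.2.1 ha
      have h2 := mul_le_mul_of_nonneg_left hp'.2.1 hb
      have h3 : a * f + b * f = f := by rw [← add_mul, hab, one_mul]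
      linarith
    · simp [hp.2.2, hp'.2.2]
  have hrayc : IsClosed ray :=
    (isClosed_eq continuous_fst continuous_const).inter
      ((isClosed_le continuous_const (Complex.continuous_re.comp continuous_snd)).inter
        (isClosed_eq (Complex.continuous_im.comp continuous_snd) continuous_const))
  have hdisj : Disjoint (φ '' B) ray := by
    rw [Set.disjoint_left]
    rintro _ ⟨Y, hY, rfl⟩ h
    exact absurd h.2.1 (not_le.2 (hf Y (mem_channelChoi_iff.2 ⟨hY.1, h.1⟩)))
  obtain ⟨g, u, v, h1, huv, h2⟩ := RCLike.geometric_hahn_banach_compact_closed (𝕜 := ℂ)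
    (hBconv.is_linear_image hlin) ((isCompact_posSemidef_trace _ m).image hφ) hray hrayc hdisj
  obtain ⟨X, t, hg⟩ := clm_apply_eq_pairing g
  have hB' : ∀ Y ∈ B, (pairing X (traceLeft Y)).re + t.re * (pairing Ω Y).re < u := by
    intro Y hY
    have h := h1 _ ⟨Y, hY, rfl⟩
    have him : (pairing Ω Y).im = 0 := (Complex.nonneg_iff.1 (pairing_nonneg hΩ hY.1)).2.symm
    simpa [φ, hg, him] using h
  have hr' : ∀ r : ℝ, f ≤ r → v < X.trace.re + t.re * r := by
    intro r hr
    have h := h2 ((1 : Matrix Q Q ℂ), (r : ℂ)) ⟨rfl, by simpa using hr, by simp⟩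
    simpa [hg, pairing_one_right] using h
  -- A negative `t.re` fails far out on the ray. If it vanished, the multiple of the identity that
  -- `traceLeft` sends to `1` would give `tr X < u < v < tr X` (real parts).
  have ht : 0 < t.re := by
    rcases lt_trichotomy t.re 0 with ht | ht | ht
    · have h := hr' (max f ((v - X.trace.re) / t.re)) (le_max_left _ _)
      have h3 := mul_le_mul_of_nonpos_left (le_max_right f ((v - X.trace.re) / t.re)) ht.le
      rw [mul_div_cancel₀ _ ht.ne] at h3
      linarith
    · have h := hr' f le_rfl
      have hd : (Fintype.card L : ℂ) ≠ 0 := by exact_mod_cast Fintype.card_ne_zero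
      have h3 := hB' (((Fintype.card L : ℝ)⁻¹ : ℝ) • 1)
        ⟨Matrix.PosSemidef.one.smul (by positivity), by
          simp [hm, Matrix.trace_smul, hd]⟩
      have h4 : traceLeft ((((Fintype.card L : ℝ)⁻¹ : ℝ) • 1 : Matrix (L × Q) (L × Q) ℂ)) = 1 := by
        ext q q'
        simp [traceLeft_apply, Matrix.one_apply, hd]
      rw [h4, pairing_one_right] at h3
      rw [ht] at h h3
      linarith
    · exact ht
  set s : ℝ := u / m with hs
  -- The dual point is the Hermitian part of `-X`, shifted and divided by `t.re`. With `s = u / m`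
  -- the shift contributes exactly `u` on matrices of trace `m`.
  set H : Matrix Q Q ℂ := ((t.re⁻¹ : ℝ) : ℂ) •
    ((s : ℂ) • 1 - (2⁻¹ : ℂ) • (X + X.conjTranspose)) with hH
  have hHh : H.IsHermitian := by
    simp only [Matrix.IsHermitian, hH, Matrix.conjTranspose_smul, Matrix.conjTranspose_sub,
      Matrix.conjTranspose_add, Matrix.conjTranspose_conjTranspose, Matrix.conjTranspose_one,
      RCLike.star_def, Complex.conj_ofReal, map_inv₀, map_ofNat, add_comm]
  have hHpair : ∀ Z : Matrix Q Q ℂ, Z.IsHermitian →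
      (pairing H Z).re = t.re⁻¹ * (s * Z.trace.re - (pairing X Z).re) := by
    intro Z hZ
    have h3 : (pairing X.conjTranspose Z).re = (pairing X Z).re := by
      have h := pairing_conjTranspose X Z
      rw [hZ.eq] at h
      rw [h]; simp
    have h4 : ((2⁻¹ : ℂ) * (pairing X Z + pairing X.conjTranspose Z)).re = (pairing X Z).re := by
      have : (2⁻¹ : ℂ) = ((2⁻¹ : ℝ) : ℂ) := by simp
      rw [this, Complex.re_ofReal_mul, Complex.add_re, h3]
      ring
    rw [hH, pairing_smul_left, pairing_sub_left, pairing_smul_left, pairing_smul_left,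
      pairing_add_left, pairing_one_left, Complex.re_ofReal_mul, Complex.sub_re,
      Complex.re_ofReal_mul, h4]
  have hfeas : ((1 : Matrix L L ℂ) ⊗ₖ H - Ω).PosSemidef := by
    refine posSemidef_of_pairing_nonneg ?_ hm0 fun Y hY hYtr => ?_
    · refine Matrix.IsHermitian.sub ?_ hΩ.isHermitian
      rw [Matrix.IsHermitian, Matrix.conjTranspose_kronecker, Matrix.conjTranspose_one, hHh.eq]
    · rw [pairing_sub_left, Complex.sub_re, pairing_one_kronecker, hHpair _ (by
        rw [Matrix.IsHermitian, conjTranspose_traceLeft, hY.isHermitian.eq]), trace_traceLeft, hYtr,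
        Complex.ofReal_re, hs, div_mul_cancel₀ _ hm0.ne']
      have h := hB' Y ⟨hY, hYtr⟩
      have h5 : t.re⁻¹ * (u - (pairing X (traceLeft Y)).re) - (pairing Ω Y).re
          = t.re⁻¹ * (u - ((pairing X (traceLeft Y)).re + t.re * (pairing Ω Y).re)) := by
        field_simp
        ring
      rw [h5]
      exact mul_nonneg (by positivity) (by linarith)
  refine ⟨H, ?_, hfeas, ?_⟩
  -- `H` is a diagonal block of `1 ⊗ₖ H`, which is positive as `Ω` plus the feasible difference.
  · have h := (hfeas.add hΩ).submatrix (fun q : Q => (Classical.arbitrary L, q))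
    convert h using 1
    ext q q'
    simp
  · have h := hHpair 1 Matrix.isHermitian_one
    rw [pairing_one_right, pairing_one_right] at h
    have h6 : (1 : Matrix Q Q ℂ).trace.re = m := by simp [hm]
    rw [h, h6, hs, div_mul_cancel₀ _ hm0.ne', inv_mul_lt_iff₀ ht]
    have := hr' f le_rfl
    linarith

/-- **Weak duality**. -/
theorem pairing_le_of_dual_feasible [Fintype L] [DecidableEq L] [Fintype Q] [DecidableEq Q]
    {Ω Y : Matrix (L × Q) (L × Q) ℂ} (hY : Y ∈ channelChoi L Q) {X : Matrix Q Q ℂ}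
    (hX : ((1 : Matrix L L ℂ) ⊗ₖ X - Ω).PosSemidef) : (pairing Ω Y).re ≤ X.trace.re := by
  have h := (Complex.nonneg_iff.1 (pairing_nonneg hX hY.1)).1
  rw [pairing_sub_left, pairing_one_kronecker, (mem_channelChoi_iff.1 hY).2, pairing_one_right,
    Complex.sub_re] at h
  linarith

end Duality

/-! ### Twirling by norm minimisation -/

section Twirl

variable {A L Q : Type*}

/-- The matrix of a linear map between matrix spaces in the basis of matrix units. -/
def superMatrix [DecidableEq A] (T : Matrix A A ℂ →ₗ[ℂ] Matrix L L ℂ) :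
    Matrix (L × L) (A × A) ℂ :=
  Matrix.of fun x y => T (Matrix.single y.1 y.2 1) x.1 x.2

theorem superMatrix_injective [Fintype A] [DecidableEq A] :
    Function.Injective (superMatrix : (Matrix A A ℂ →ₗ[ℂ] Matrix L L ℂ) → _) := by
  intro T T' h
  refine LinearMap.ext fun Z => Matrix.ext fun a b => ?_
  rw [map_apply_eq_sum T, map_apply_eq_sum T']
  refine Finset.sum_congr rfl fun q _ => Finset.sum_congr rfl fun q' _ => ?_
  congr 1
  exact congrFun (congrFun h (a, b)) (q, q')

theorem superMatrix_comp [Fintype A] [DecidableEq A] [DecidableEq Q]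
    (T : Matrix A A ℂ →ₗ[ℂ] Matrix L L ℂ) (S : Matrix Q Q ℂ →ₗ[ℂ] Matrix A A ℂ) :
    superMatrix (T ∘ₗ S) = superMatrix T * superMatrix S := by
  ext x y
  rw [Matrix.mul_apply, Fintype.sum_prod_type]
  refine (map_apply_eq_sum T (S (Matrix.single y.1 y.2 1)) x.1 x.2).trans ?_
  refine Finset.sum_congr rfl fun q _ => Finset.sum_congr rfl fun q' _ => ?_
  exact mul_comm _ _

theorem superMatrix_id [DecidableEq A] :
    superMatrix (LinearMap.id : Matrix A A ℂ →ₗ[ℂ] Matrix A A ℂ) = 1 := by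
  ext x y
  simp [superMatrix, Matrix.single_apply, Matrix.one_apply, Prod.ext_iff, eq_comm]

theorem superMatrix_conjMap_apply [Fintype A] [DecidableEq A] (U : Matrix A A ℂ) (x y : A × A) :
    superMatrix (conjMap U) x y = U x.1 y.1 * star (U x.2 y.2) := by
  simp [superMatrix, conjMap_apply, Matrix.mul_apply, Matrix.single_apply, ite_and]

theorem conjTranspose_superMatrix_conjMap [Fintype A] [DecidableEq A] (U : Matrix A A ℂ) :
    (superMatrix (conjMap U)).conjTranspose = superMatrix (conjMap U.conjTranspose) := by
  ext x y
  simp [superMatrix_conjMap_apply]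

theorem conjMap_comp_conjMap [Fintype A] (U V : Matrix A A ℂ) :
    conjMap U ∘ₗ conjMap V = conjMap (U * V) := by
  ext1 X
  simp [conjMap_apply, Matrix.mul_assoc]

theorem conjMap_one [Fintype A] [DecidableEq A] :
    conjMap (1 : Matrix A A ℂ) = LinearMap.id := by
  ext1 X
  simp [conjMap_apply]

/-- The conjugate `Ad_U† ∘ T ∘ Ad_U` of a linear map `T`. -/
def twist [Fintype L] (U : Matrix L L ℂ) (T : Matrix L L ℂ →ₗ[ℂ] Matrix L L ℂ) :
    Matrix L L ℂ →ₗ[ℂ] Matrix L L ℂ :=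
  conjMap U.conjTranspose ∘ₗ T ∘ₗ conjMap U

/-- For unitary `U` this is a unitary change of basis, so twisting preserves the trace and the
Hilbert-Schmidt norm of the superoperator. -/
theorem superMatrix_twist [Fintype L] [DecidableEq L] (U : Matrix L L ℂ)
    (T : Matrix L L ℂ →ₗ[ℂ] Matrix L L ℂ) :
    superMatrix (twist U T) =
      (superMatrix (conjMap U)).conjTranspose * superMatrix T * superMatrix (conjMap U) := by
  rw [twist, superMatrix_comp, superMatrix_comp, conjTranspose_superMatrix_conjMap,
    Matrix.mul_assoc]

theorem superMatrix_conjMap_mul_conjTranspose [Fintype L] [DecidableEq L] {U : Matrix L L ℂ}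
    (hU : U ∈ Matrix.unitaryGroup L ℂ) :
    superMatrix (conjMap U) * (superMatrix (conjMap U)).conjTranspose = 1 := by
  rw [conjTranspose_superMatrix_conjMap, ← superMatrix_comp, conjMap_comp_conjMap,
    ← Matrix.star_eq_conjTranspose, Matrix.mem_unitaryGroup_iff.1 hU, conjMap_one, superMatrix_id]

theorem trace_superMatrix_twist [Fintype L] [DecidableEq L] {U : Matrix L L ℂ}
    (hU : U ∈ Matrix.unitaryGroup L ℂ) (T : Matrix L L ℂ →ₗ[ℂ] Matrix L L ℂ) :
    (superMatrix (twist U T)).trace = (superMatrix T).trace := by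
  rw [superMatrix_twist, Matrix.trace_mul_comm, ← Matrix.mul_assoc,
    superMatrix_conjMap_mul_conjTranspose hU, Matrix.one_mul]

/-- The squared Hilbert-Schmidt norm. -/
def hsSq [Fintype A] (M : Matrix A A ℂ) : ℝ := ∑ x, ∑ y, Complex.normSq (M x y)

theorem hsSq_eq_trace [Fintype A] (M : Matrix A A ℂ) :
    (hsSq M : ℂ) = (M.conjTranspose * M).trace := by
  simp only [hsSq, Matrix.trace, Matrix.diag_apply, Matrix.mul_apply, Matrix.conjTranspose_apply,
    Complex.ofReal_sum, Complex.normSq_eq_conj_mul_self]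
  rw [Finset.sum_comm]
  rfl

theorem hsSq_superMatrix_twist [Fintype L] [DecidableEq L] {U : Matrix L L ℂ}
    (hU : U ∈ Matrix.unitaryGroup L ℂ) (T : Matrix L L ℂ →ₗ[ℂ] Matrix L L ℂ) :
    hsSq (superMatrix (twist U T)) = hsSq (superMatrix T) := by
  have h : (hsSq (superMatrix (twist U T)) : ℂ) = hsSq (superMatrix T) := by
    rw [hsSq_eq_trace, hsSq_eq_trace, superMatrix_twist]
    set W := superMatrix (conjMap U)
    set M := superMatrix T
    have hW : W * W.conjTranspose = 1 := superMatrix_conjMap_mul_conjTranspose hU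
    have : (W.conjTranspose * M * W).conjTranspose * (W.conjTranspose * M * W)
        = W.conjTranspose * (M.conjTranspose * M) * W := by
      simp only [Matrix.conjTranspose_mul, Matrix.conjTranspose_conjTranspose]
      calc _ = W.conjTranspose * M.conjTranspose * (W * W.conjTranspose) * M * W := by
            simp only [Matrix.mul_assoc]
        _ = _ := by rw [hW, Matrix.mul_one]; simp only [Matrix.mul_assoc]
    rw [this, Matrix.trace_mul_comm, ← Matrix.mul_assoc, hW, Matrix.one_mul]
  exact_mod_cast h

/-- Strict convexity, through the parallelogram identity. -/
theorem eq_of_hsSq_midpoint [Fintype A] {M M' : Matrix A A ℂ} (h : hsSq M' = hsSq M)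
    (hm : hsSq M ≤ hsSq ((2⁻¹ : ℂ) • (M + M'))) : M = M' := by
  have key : hsSq ((2⁻¹ : ℂ) • (M + M')) + hsSq (M - M') / 4 = (hsSq M + hsSq M') / 2 := by
    simp only [hsSq, Finset.sum_div, ← Finset.sum_add_distrib]
    refine Finset.sum_congr rfl fun x _ => Finset.sum_congr rfl fun y _ => ?_
    simp [Complex.normSq_apply, -map_mul]
    ring
  have h0 : hsSq (M - M') = 0 :=
    le_antisymm (by linarith)
      (Finset.sum_nonneg fun x _ => Finset.sum_nonneg fun y _ => Complex.normSq_nonneg _)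
  ext x y
  have h1 := (Finset.sum_eq_zero_iff_of_nonneg
    (f := fun x => ∑ y, Complex.normSq ((M - M') x y))
    (fun x _ => Finset.sum_nonneg fun y _ => Complex.normSq_nonneg _)).1 h0 x (Finset.mem_univ x)
  have h2 := (Finset.sum_eq_zero_iff_of_nonneg (f := fun y => Complex.normSq ((M - M') x y))
    (fun y _ => Complex.normSq_nonneg _)).1 h1 y (Finset.mem_univ y)
  exact sub_eq_zero.1 (Complex.normSq_eq_zero.1 h2)

theorem choiMap_midpoint [Fintype Q] (Y Y' : Matrix (L × Q) (L × Q) ℂ) :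
    choiMap ((2⁻¹ : ℂ) • (Y + Y')) = (2⁻¹ : ℂ) • (choiMap Y + choiMap Y') := by
  refine LinearMap.ext fun Z => Matrix.ext fun a b => ?_
  simp only [choiMap_apply, LinearMap.smul_apply, LinearMap.add_apply, Matrix.smul_apply,
    Matrix.add_apply, smul_eq_mul, ← Finset.sum_add_distrib, Finset.mul_sum]
  refine Finset.sum_congr rfl fun q _ => Finset.sum_congr rfl fun q' _ => ?_
  ring

theorem midpoint_mem_channelChoi [Fintype L] [DecidableEq Q] {Y Y' : Matrix (L × Q) (L × Q) ℂ}
    (h : Y ∈ channelChoi L Q) (h' : Y' ∈ channelChoi L Q) :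
    (2⁻¹ : ℂ) • (Y + Y') ∈ channelChoi L Q := by
  refine ⟨(h.1.add h'.1).smul (by simp), fun q q' => ?_⟩
  simp only [Matrix.smul_apply, Matrix.add_apply, ← Finset.smul_sum, Finset.sum_add_distrib, h.2,
    h'.2]
  split_ifs <;> norm_num

theorem continuous_choiMap_apply [Fintype Q] (Z : Matrix Q Q ℂ) :
    Continuous fun Y : Matrix (L × Q) (L × Q) ℂ => choiMap Y Z := by
  refine continuous_matrix fun a b => ?_
  simp only [choiMap_apply]
  fun_prop

/-- **Twirling**: a closed, midpoint-convex and unitarily invariant condition on the composition of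
a covariant map with a channel is satisfied by a channel making the composition covariant, if it is
satisfied at all. -/
theorem exists_covariant [Fintype L] [DecidableEq L] [Fintype Q] [DecidableEq Q]
    {N : Matrix L L ℂ →ₗ[ℂ] Matrix Q Q ℂ}
    (hN : ∀ U ∈ Matrix.unitaryGroup L ℂ, ∃ V ∈ Matrix.unitaryGroup Q ℂ,
      N ∘ₗ conjMap U = conjMap V ∘ₗ N)
    (p : (Matrix L L ℂ →ₗ[ℂ] Matrix L L ℂ) → Prop)
    (hclosed : IsClosed {Y : Matrix (L × Q) (L × Q) ℂ | p (choiMap Y ∘ₗ N)})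
    (hmid : ∀ T T', p T → p T' → p ((2⁻¹ : ℂ) • (T + T')))
    (hinv : ∀ U ∈ Matrix.unitaryGroup L ℂ, ∀ T, p T → p (twist U T))
    (h : ∃ D : Matrix Q Q ℂ →ₗ[ℂ] Matrix L L ℂ, IsChannel D ∧ p (D ∘ₗ N)) :
    ∃ D : Matrix Q Q ℂ →ₗ[ℂ] Matrix L L ℂ, IsChannel D ∧ p (D ∘ₗ N) ∧
      ∀ U ∈ Matrix.unitaryGroup L ℂ, twist U (D ∘ₗ N) = D ∘ₗ N := by
  have hcont : Continuous fun Y : Matrix (L × Q) (L × Q) ℂ =>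
      hsSq (superMatrix (choiMap Y ∘ₗ N)) := by
    refine continuous_finsetSum _ fun x _ => continuous_finsetSum _ fun y _ =>
      Complex.continuous_normSq.comp ?_
    exact ((continuous_choiMap_apply _).matrix_elem x.1 x.2)
  obtain ⟨D₀, hD₀, hp₀⟩ := h
  -- Among admissible channels, take one whose composition with `N` has least Hilbert-Schmidt norm.
  -- Any twist of the composition has the same norm, so uniqueness of the minimiser makes it
  -- covariant.
  obtain ⟨Y, hY, hmin⟩ := ((isCompact_channelChoi L Q).inter_right hclosed).exists_isMinOn
    ⟨choiMatrix D₀, hD₀.choiMatrix_mem, by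
      change p _
      rwa [choiMap_choiMatrix]⟩ hcont.continuousOn
  refine ⟨choiMap Y, isChannel_choiMap hY.1, hY.2, fun U hU => ?_⟩
  obtain ⟨V, hV, hNV⟩ := hN U hU
  -- Covariance of `N` is what makes the twisted composition again a channel applied after `N`.
  set D' := conjMap U.conjTranspose ∘ₗ choiMap Y ∘ₗ conjMap V with hD'
  have hD'N : D' ∘ₗ N = twist U (choiMap Y ∘ₗ N) := by
    rw [hD', twist, LinearMap.comp_assoc, LinearMap.comp_assoc, ← hNV, LinearMap.comp_assoc]
  have hD'c : IsChannel D' := by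
    refine (isChannel_conjMap ?_).comp ((isChannel_choiMap hY.1).comp (isChannel_conjMap hV))
    exact Unitary.star_mem hU
  have hp' : p (D' ∘ₗ N) := by
    rw [hD'N]
    exact hinv U hU _ hY.2
  have hadd : choiMap ((2⁻¹ : ℂ) • (Y + choiMatrix D')) ∘ₗ N
      = (2⁻¹ : ℂ) • (choiMap Y ∘ₗ N + D' ∘ₗ N) := by
    rw [choiMap_midpoint, choiMap_choiMatrix, LinearMap.smul_comp, LinearMap.add_comp]
  have hle := hmin (a := (2⁻¹ : ℂ) • (Y + choiMatrix D'))
    ⟨midpoint_mem_channelChoi hY.1 hD'c.choiMatrix_mem, by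
      change p _
      rw [hadd]
      exact hmid _ _ hY.2 hp'⟩
  simp only [Set.mem_ofPred_eq] at hle
  rw [hadd, hD'N] at hle
  refine (superMatrix_injective (eq_of_hsSq_midpoint (hsSq_superMatrix_twist hU _) ?_)).symm
  exact hle

end Twirl

/-! ### Fidelity with pure states and its value for covariant maps -/

section Fidelity

variable {A L Q : Type*}

/-- The overlap `⟨v|T(|v⟩⟨v|)|v⟩`. -/
def overlap [Fintype L] (T : Matrix L L ℂ →ₗ[ℂ] Matrix L L ℂ) (v : L → ℂ) : ℂ :=
  star v ⬝ᵥ (T (Matrix.vecMulVec v (star v))).mulVec v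

theorem vecMulVec_mulVec_star [Fintype L] (U : Matrix L L ℂ) (v : L → ℂ) :
    Matrix.vecMulVec (U.mulVec v) (star (U.mulVec v)) = conjMap U (Matrix.vecMulVec v (star v)) := by
  rw [conjMap_apply, Matrix.mul_vecMulVec, Matrix.vecMulVec_mul, Matrix.star_mulVec]

theorem overlap_mulVec [Fintype L] (U : Matrix L L ℂ) (T : Matrix L L ℂ →ₗ[ℂ] Matrix L L ℂ)
    (v : L → ℂ) : overlap T (U.mulVec v) = overlap (twist U T) v := by
  rw [overlap, overlap, vecMulVec_mulVec_star, Matrix.star_mulVec]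
  simp only [twist, LinearMap.comp_apply]
  rw [conjMap_apply U.conjTranspose, Matrix.conjTranspose_conjTranspose, ← Matrix.mulVec_mulVec,
    ← Matrix.mulVec_mulVec, Matrix.dotProduct_mulVec (star v)]

theorem exists_unitary_mulVec_single [Fintype L] [DecidableEq L] {v : L → ℂ}
    (hv : star v ⬝ᵥ v = 1) (i : L) :
    ∃ U ∈ Matrix.unitaryGroup L ℂ, U.mulVec (Pi.single i 1) = v := by
  have hnorm : ‖(WithLp.toLp 2 v : EuclideanSpace ℂ L)‖ = 1 := by
    have h : (inner ℂ (WithLp.toLp 2 v : EuclideanSpace ℂ L) (WithLp.toLp 2 v)) = (1 : ℂ) := by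
      rw [EuclideanSpace.inner_eq_star_dotProduct, dotProduct_comm]
      exact hv
    have h' := inner_self_eq_norm_sq (𝕜 := ℂ) (WithLp.toLp 2 v : EuclideanSpace ℂ L)
    rw [h] at h'
    exact (pow_eq_one_iff_of_nonneg (norm_nonneg _) two_ne_zero).1 (by simpa using h'.symm)
  obtain ⟨b, hb⟩ := Orthonormal.exists_orthonormalBasis_extension_of_card_eq (𝕜 := ℂ)
    (E := EuclideanSpace ℂ L) (ι := L) (by simp) (v := fun _ => WithLp.toLp 2 v) (s := {i})
    (by
      constructor
      · rintro ⟨j, hj⟩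
        exact hnorm
      · rintro ⟨j, hj⟩ ⟨k, hk⟩ hjk
        exact absurd (Subtype.ext (hj.trans hk.symm)) hjk)
  refine ⟨(EuclideanSpace.basisFun L ℂ).toBasis.toMatrix b,
    OrthonormalBasis.toMatrix_orthonormalBasis_mem_unitary _ _, ?_⟩
  ext j
  simp [Module.Basis.toMatrix_apply, hb i rfl]

/-- Unitaries act transitively on unit vectors, and the overlap scales as the fourth power of the
norm. Unnormalised vectors are needed for the phase sums below. -/
theorem overlap_eq_of_covariant [Fintype L] [DecidableEq L]
    {T : Matrix L L ℂ →ₗ[ℂ] Matrix L L ℂ}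
    (hT : ∀ U ∈ Matrix.unitaryGroup L ℂ, twist U T = T) (i : L) (v : L → ℂ) :
    overlap T v = (star v ⬝ᵥ v) ^ 2 * overlap T (Pi.single i 1) := by
  by_cases hv : v = 0
  · simp [hv, overlap]
  have hpos : 0 < star v ⬝ᵥ v := Matrix.dotProduct_star_self_pos_iff.2 hv
  obtain ⟨h1, h2⟩ := Complex.pos_iff.1 hpos
  set r : ℝ := (star v ⬝ᵥ v).re
  have hr : star v ⬝ᵥ v = (r : ℂ) := Complex.ext rfl (by simp [← h2])
  set s : ℝ := Real.sqrt r
  have hs : s * s = r := Real.mul_self_sqrt h1.le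
  have hs0 : s ≠ 0 := (Real.sqrt_pos.2 h1).ne'
  have hs0' : (s : ℂ) ≠ 0 := by exact_mod_cast hs0
  have hsr : (s : ℂ) * s = r := by exact_mod_cast hs
  obtain ⟨U, hU, hUv⟩ := exists_unitary_mulVec_single (v := ((s : ℂ)⁻¹) • v) (by
    simp only [star_smul, smul_dotProduct, dotProduct_smul, hr, ← hsr, smul_eq_mul, RCLike.star_def,
      map_inv₀, Complex.conj_ofReal]
    field_simp) i
  have hscale : overlap T v = r ^ 2 * overlap T (((s : ℂ)⁻¹) • v) := by
    simp only [overlap, star_smul, Matrix.smul_vecMulVec, Matrix.vecMulVec_smul, map_smul,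
      Matrix.smul_mulVec, Matrix.mulVec_smul, smul_dotProduct, dotProduct_smul, smul_eq_mul, ← hsr,
      RCLike.star_def, map_inv₀, Complex.conj_ofReal]
    field_simp
  rw [hscale, ← hUv, overlap_mulVec, hT U hU, hr]

theorem overlap_single [Fintype L] [DecidableEq L] (T : Matrix L L ℂ →ₗ[ℂ] Matrix L L ℂ) (a : L) :
    overlap T (Pi.single a 1) = T (Matrix.single a a 1) a a := by
  have h : Matrix.vecMulVec (Pi.single a (1 : ℂ)) (star (Pi.single a 1)) = Matrix.single a a 1 := by
    rw [Matrix.single_eq_single_vecMulVec_single]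
    congr 1
    simp
  rw [overlap, h]
  simp

theorem overlap_add_smul_single [Fintype L] [DecidableEq L]
    (T : Matrix L L ℂ →ₗ[ℂ] Matrix L L ℂ) (a b : L) (w : ℂ) :
    overlap T (Pi.single a 1 + w • Pi.single b 1) =
      let M := T (Matrix.single a a 1) + star w • T (Matrix.single a b 1)
        + w • T (Matrix.single b a 1) + (w * star w) • T (Matrix.single b b 1)
      M a a + w * M a b + star w * M b a + w * star w * M b b := by
  have h : Matrix.vecMulVec (Pi.single a (1 : ℂ) + w • Pi.single b 1)
      (star (Pi.single a 1 + w • Pi.single b 1)) = Matrix.single a a 1 + star w • Matrix.single a b 1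
        + w • Matrix.single b a 1 + (w * star w) • Matrix.single b b 1 := by
    simp only [Matrix.single_eq_single_vecMulVec_single, star_add, star_smul, ← Pi.single_star,
      star_one, Matrix.vecMulVec_add, Matrix.add_vecMulVec, Matrix.smul_vecMulVec,
      Matrix.vecMulVec_smul, smul_add, smul_smul, mul_comm w]
    abel
  set M := T (Matrix.single a a 1) + star w • T (Matrix.single a b 1)
        + w • T (Matrix.single b a 1) + (w * star w) • T (Matrix.single b b 1) with hMdef
  change _ = M a a + w * M a b + star w * M b a + w * star w * M b b
  have hM : T (Matrix.single a a 1 + star w • Matrix.single a b 1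
        + w • Matrix.single b a 1 + (w * star w) • Matrix.single b b 1) = M := by
    simp only [map_add, map_smul, hMdef]
  rw [overlap, h, hM]
  simp only [star_add, star_smul, ← Pi.single_star, star_one, Matrix.mulVec_add, Matrix.mulVec_smul,
    add_dotProduct, dotProduct_add, smul_dotProduct, dotProduct_smul, Matrix.mulVec_single_one,
    single_one_dotProduct, Matrix.col_apply, smul_eq_mul]
  ring

theorem star_dotProduct_add_smul_single [Fintype L] [DecidableEq L] (a b : L) (w : ℂ) :
    star (Pi.single a 1 + w • Pi.single b 1 : L → ℂ) ⬝ᵥ (Pi.single a 1 + w • Pi.single b 1) =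
      1 + w * star w + (if a = b then w + star w else 0) := by
  simp only [star_add, star_smul, ← Pi.single_star, star_one,
    add_dotProduct, dotProduct_add, smul_dotProduct, dotProduct_smul,
    single_one_dotProduct, smul_eq_mul, Pi.single_apply]
  split_ifs <;> simp_all
  all_goals ring

/-- On `e_a + w e_b` with `|w| = 1` the overlap is a Laurent polynomial in `w` with exponents from
-2 to 2. Summing over the fourth roots of unity leaves four times its constant term. -/
theorem sum_overlap_phases [Fintype L] [DecidableEq L]
    (T : Matrix L L ℂ →ₗ[ℂ] Matrix L L ℂ) (a b : L) :
    overlap T (Pi.single a 1 + (1 : ℂ) • Pi.single b 1)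
      + overlap T (Pi.single a 1 + (-1 : ℂ) • Pi.single b 1)
      + overlap T (Pi.single a 1 + Complex.I • Pi.single b 1)
      + overlap T (Pi.single a 1 + (-Complex.I) • Pi.single b 1)
      = 4 * (T (Matrix.single a a 1) a a + T (Matrix.single b b 1) b b
        + T (Matrix.single a a 1) b b + T (Matrix.single b b 1) a a
        + T (Matrix.single a b 1) a b + T (Matrix.single b a 1) b a) := by
  simp only [overlap_add_smul_single, Matrix.add_apply, Matrix.smul_apply, smul_eq_mul, star_one,
    star_neg, RCLike.star_def, Complex.conj_I]
  have hI : Complex.I * Complex.I = -1 := Complex.I_mul_I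
  generalize Complex.I = J at *
  grind

/-- The constant overlap of a covariant trace-preserving map is determined by its trace. -/
theorem card_add_trace_superMatrix [Fintype L] [DecidableEq L]
    {T : Matrix L L ℂ →ₗ[ℂ] Matrix L L ℂ} (htr : ∀ X, (T X).trace = X.trace)
    (hT : ∀ U ∈ Matrix.unitaryGroup L ℂ, twist U T = T) (i : L) :
    (Fintype.card L : ℂ) + (superMatrix T).trace =
      overlap T (Pi.single i 1) * (Fintype.card L * (Fintype.card L + 1)) := by
  set F := overlap T (Pi.single i 1)
  have hdiag : ∀ a, T (Matrix.single a a 1) a a = F := fun a => by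
    rw [← overlap_single, overlap_eq_of_covariant hT i]
    simp [F]
  -- For `a ≠ b` the four vectors all have squared norm 2. For `a = b` the squared norms are 4, 0,
  -- 2, 2, which produces the extra `2 * F`.
  have hpair : ∀ a b, T (Matrix.single a a 1) b b + T (Matrix.single b b 1) a a
      + T (Matrix.single a b 1) a b + T (Matrix.single b a 1) b a
      = 2 * F + (if a = b then 2 * F else 0) := by
    intro a b
    have h := sum_overlap_phases T a b
    have hF : ∀ w : ℂ, overlap T (Pi.single a 1 + w • Pi.single b 1) =
        (1 + w * star w + (if a = b then w + star w else 0)) ^ 2 * F := fun w => by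
      rw [overlap_eq_of_covariant hT i, star_dotProduct_add_smul_single]
    rw [hF, hF, hF, hF, hdiag, hdiag] at h
    simp only [star_neg, star_one, RCLike.star_def, Complex.conj_I] at h
    have hI : Complex.I * Complex.I = -1 := Complex.I_mul_I
    clear_value F
    clear hF
    generalize Complex.I = J at *
    split_ifs at h ⊢ <;> grind
  have hsum := Finset.sum_congr rfl fun a (_ : a ∈ Finset.univ) =>
    Finset.sum_congr rfl fun b (_ : b ∈ Finset.univ) => hpair a b
  have hT1 : ∑ a, ∑ b, T (Matrix.single a a 1) b b = Fintype.card L := by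
    have : ∀ a, ∑ b, T (Matrix.single a a 1) b b = 1 := fun a =>
      (htr (Matrix.single a a 1)).trans (by simp)
    simp [this]
  have hT2 : ∑ a, ∑ b, T (Matrix.single a b 1) a b = (superMatrix T).trace := by
    simp [superMatrix, Matrix.trace, Fintype.sum_prod_type]
  have hT3 : ∑ a, ∑ b, T (Matrix.single b b 1) a a = Fintype.card L := by
    rw [Finset.sum_comm, hT1]
  have hT4 : ∑ a, ∑ b, T (Matrix.single b a 1) b a = (superMatrix T).trace := by
    rw [Finset.sum_comm, hT2]
  simp only [Finset.sum_add_distrib, hT1, hT2, hT3, hT4, Finset.sum_const,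
    Finset.card_univ, nsmul_eq_mul, Finset.sum_ite_eq, Finset.mem_univ, if_true] at hsum
  linear_combination hsum / 2

open scoped MatrixOrder in
-- With `w = √ρ v`, the matrix under the outer root is `|w⟩⟨w|`. Its root is `|w⟩⟨w| / ‖w‖`, of
-- trace `‖w‖`; the case `w = 0` is separate because of the division.
theorem fidelity_pure [Fintype A] [DecidableEq A] {ρ : Matrix A A ℂ} (hρ : ρ.PosSemidef)
    (v : A → ℂ) : fidelity ρ (Matrix.vecMulVec v (star v)) = (star v ⬝ᵥ ρ.mulVec v).re := by
  set R := CFC.sqrt ρ with hR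
  have hRp : R.PosSemidef := Matrix.nonneg_iff_posSemidef.1 (CFC.sqrt_nonneg ρ)
  have hRR : R * R = ρ := CFC.sqrt_mul_sqrt_self ρ hρ.nonneg
  set w := R.mulVec v with hw
  have h1 : R * Matrix.vecMulVec v (star v) * R = Matrix.vecMulVec w (star w) := by
    rw [Matrix.mul_vecMulVec, Matrix.vecMulVec_mul, hw, Matrix.star_mulVec, hRp.isHermitian.eq]
  have h2 : star v ⬝ᵥ ρ.mulVec v = star w ⬝ᵥ w := by
    rw [hw, Matrix.star_mulVec, hRp.isHermitian.eq, ← Matrix.dotProduct_mulVec, Matrix.mulVec_mulVec,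
      hRR]
  rw [fidelity, ← hR, h1, h2]
  have hnn : 0 ≤ star w ⬝ᵥ w := dotProduct_star_self_nonneg w
  obtain ⟨h3, h4⟩ := Complex.nonneg_iff.1 hnn
  set r := (star w ⬝ᵥ w).re with hr
  have hrc : star w ⬝ᵥ w = (r : ℂ) := Complex.ext rfl (by simp [← h4])
  set s := Real.sqrt r with hs
  have hss : s * s = r := Real.mul_self_sqrt h3
  by_cases hw0 : w = 0
  · have : r = 0 := by rw [hr, hw0]; simp
    rw [hw0, this]
    simp
  have hs0 : s ≠ 0 := by
    intro h0
    rw [h0, mul_zero] at hss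
    refine hw0 (dotProduct_star_self_eq_zero.1 ?_)
    rw [hrc, ← hss, Complex.ofReal_zero]
  have hs0' : (s : ℂ) ≠ 0 := by exact_mod_cast hs0
  have hssc : (s : ℂ) * s = r := by exact_mod_cast hss
  have hsqrt : CFC.sqrt (Matrix.vecMulVec w (star w)) =
      ((s⁻¹ : ℝ) : ℂ) • Matrix.vecMulVec w (star w) := by
    refine CFC.sqrt_unique ?_ ?_
    · rw [Matrix.smul_mul, Matrix.mul_smul, Matrix.vecMulVec_mul_vecMulVec, hrc, smul_smul,
        Matrix.vecMulVec_smul, smul_smul, ← hssc]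
      push_cast
      field_simp
      rw [one_smul]
    · refine ((Matrix.posSemidef_vecMulVec_self_star w).smul ?_).nonneg
      exact_mod_cast inv_nonneg.2 (Real.sqrt_nonneg r)
  rw [hsqrt, Matrix.trace_smul, Matrix.trace_vecMulVec, dotProduct_comm, hrc, smul_eq_mul,
    ← Complex.ofReal_mul, Complex.ofReal_re, ← hss]
  field_simp

end Fidelity

/-! ### Erasure as a partial trace, and its covariance -/

section Erasure

variable {n : ℕ} {P : Fin n → Type*}

theorem erasure_apply [∀ i, Fintype (P i)] (S : Finset (Fin n))
    (M : Matrix (∀ i, P i) (∀ i, P i) ℂ) (a b : ∀ i : {i // ¬ i ∈ S}, P i) :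
    erasure S M a b = ∑ e : (∀ i : {i // i ∈ S}, P i),
      M ((Equiv.piEquivPiSubtypeProd (fun i => i ∈ S) P).symm (e, a))
        ((Equiv.piEquivPiSubtypeProd (fun i => i ∈ S) P).symm (e, b)) := rfl

/-- With an ancilla attached, erasure is a sum of principal submatrices, one for each basis state of
the erased systems. -/
theorem isChannel_erasure [∀ i, Fintype (P i)] (S : Finset (Fin n)) :
    IsChannel (erasure (P := P) S) := by
  refine ⟨fun k M hM => ?_, fun X => ?_⟩
  · have h := Matrix.posSemidef_sum (Finset.univ : Finset (∀ i : {i // i ∈ S}, P i))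
      (x := fun e => M.submatrix
        (fun x : Fin k × (∀ i : {i // ¬ i ∈ S}, P i) =>
          (x.1, (Equiv.piEquivPiSubtypeProd (fun i => i ∈ S) P).symm (e, x.2)))
        (fun x : Fin k × (∀ i : {i // ¬ i ∈ S}, P i) =>
          (x.1, (Equiv.piEquivPiSubtypeProd (fun i => i ∈ S) P).symm (e, x.2))))
      (fun e _ => hM.submatrix _)
    convert h using 1
    ext x y
    rw [Matrix.sum_apply]
    rfl
  · simp only [Matrix.trace, Matrix.diag_apply, erasure_apply]
    rw [Finset.sum_comm, ← Fintype.sum_prod_type'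
      (f := fun e a => X ((Equiv.piEquivPiSubtypeProd (fun i => i ∈ S) P).symm (e, a))
        ((Equiv.piEquivPiSubtypeProd (fun i => i ∈ S) P).symm (e, a)))]
    exact Equiv.sum_comp (Equiv.piEquivPiSubtypeProd (fun i => i ∈ S) P).symm (fun x => X x x)

/-- The tensor product of a finite family of operators. -/
def prodTensor {ι : Type*} [Fintype ι] {P : ι → Type*} (V : ∀ i, Matrix (P i) (P i) ℂ) :
    Matrix (∀ i, P i) (∀ i, P i) ℂ :=
  Matrix.of fun a b => ∏ i, V i (a i) (b i)

theorem prodTensor_mem_unitaryGroup {ι : Type*} [Fintype ι] [DecidableEq ι] {P : ι → Type*}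
    [∀ i, Fintype (P i)] [∀ i, DecidableEq (P i)] {V : ∀ i, Matrix (P i) (P i) ℂ}
    (hV : ∀ i, V i ∈ Matrix.unitaryGroup (P i) ℂ) :
    prodTensor V ∈ Matrix.unitaryGroup (∀ i, P i) ℂ := by
  rw [Matrix.mem_unitaryGroup_iff]
  ext a b
  simp only [Matrix.mul_apply, Matrix.star_apply, prodTensor, Matrix.of_apply, star_prod,
    ← Finset.prod_mul_distrib]
  rw [← Fintype.prod_sum (fun i c => V i (a i) c * star (V i (b i) c))]
  have h : ∀ i, ∑ c, V i (a i) c * star (V i (b i) c) = if a i = b i then 1 else 0 := fun i => by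
    have h := congrFun (congrFun (Matrix.mem_unitaryGroup_iff.1 (hV i)) (a i)) (b i)
    rw [Matrix.mul_apply, Matrix.one_apply] at h
    simpa only [Matrix.star_apply] using h
  simp only [h, Matrix.one_apply, funext_iff, Finset.prod_ite_zero, Finset.mem_univ, true_implies,
    Finset.prod_const_one]

theorem piTensor_symm_apply [∀ i, Fintype (P i)] (S : Finset (Fin n))
    (V : ∀ i, Matrix (P i) (P i) ℂ) (x y : (∀ i : {i // i ∈ S}, P i) × (∀ i : {i // ¬ i ∈ S}, P i)) :
    piTensor V ((Equiv.piEquivPiSubtypeProd (fun i => i ∈ S) P).symm x)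
      ((Equiv.piEquivPiSubtypeProd (fun i => i ∈ S) P).symm y) =
      prodTensor (fun i : {i // i ∈ S} => V i) x.1 y.1 *
        prodTensor (fun i : {i // ¬ i ∈ S} => V i) x.2 y.2 := by
  simp only [piTensor, prodTensor, Matrix.of_apply]
  rw [← Fintype.prod_subtype_mul_prod_subtype (fun i => i ∈ S)]
  congr 1
  · refine Finset.prod_congr (Finset.ext fun _ => by simp) fun i _ => ?_
    simp [Equiv.piEquivPiSubtypeProd, i.2]
  · refine Finset.prod_congr (Finset.ext fun _ => by simp) fun i _ => ?_
    simp [Equiv.piEquivPiSubtypeProd, i.2]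

theorem traceLeft_one_kronecker_mul {A B : Type*} [Fintype A] [DecidableEq A] [Fintype B]
    (V : Matrix B B ℂ) (M : Matrix (A × B) (A × B) ℂ) :
    traceLeft (((1 : Matrix A A ℂ) ⊗ₖ V) * M) = V * traceLeft M := by
  ext a b
  simp only [traceLeft_apply, Matrix.mul_apply, Fintype.sum_prod_type, Matrix.kroneckerMap_apply,
    Matrix.one_apply, ite_mul, one_mul, zero_mul, Finset.sum_ite_irrel, Finset.sum_const_zero,
    Finset.sum_ite_eq, Finset.mem_univ, if_true, Finset.mul_sum]
  rw [Finset.sum_comm]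

theorem traceLeft_mul_one_kronecker {A B : Type*} [Fintype A] [DecidableEq A] [Fintype B]
    (V : Matrix B B ℂ) (M : Matrix (A × B) (A × B) ℂ) :
    traceLeft (M * ((1 : Matrix A A ℂ) ⊗ₖ V)) = traceLeft M * V := by
  ext a b
  simp only [traceLeft_apply, Matrix.mul_apply, Fintype.sum_prod_type, Matrix.kroneckerMap_apply,
    Matrix.one_apply, ite_mul, one_mul, zero_mul, mul_ite, mul_zero, Finset.sum_ite_irrel,
    Finset.sum_const_zero, Finset.sum_ite_eq', Finset.mem_univ, if_true, Finset.sum_mul]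
  rw [Finset.sum_comm]

/-- Partial traces are cyclic for operators supported on the traced factor, which lets erased gates
cancel. -/
theorem traceLeft_kronecker_one_mul_comm {A B : Type*} [Fintype A] [Fintype B] [DecidableEq B]
    (W : Matrix A A ℂ) (M : Matrix (A × B) (A × B) ℂ) :
    traceLeft ((W ⊗ₖ (1 : Matrix B B ℂ)) * M) = traceLeft (M * (W ⊗ₖ (1 : Matrix B B ℂ))) := by
  ext a b
  simp only [traceLeft_apply, Matrix.mul_apply, Fintype.sum_prod_type, Matrix.kroneckerMap_apply,
    Matrix.one_apply, ite_mul, mul_one, zero_mul, mul_ite, mul_zero, Finset.sum_ite_eq,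
    Finset.sum_ite_eq', Finset.mem_univ, if_true]
  rw [Finset.sum_comm]
  exact Finset.sum_congr rfl fun _ _ => Finset.sum_congr rfl fun _ _ => mul_comm _ _

/-- The partial trace over a subsystem absorbs unitaries acting on that subsystem. -/
theorem traceLeft_kronecker_conj {A B : Type*} [Fintype A] [DecidableEq A] [Fintype B]
    [DecidableEq B] {W : Matrix A A ℂ} (hW : W ∈ Matrix.unitaryGroup A ℂ) (V : Matrix B B ℂ)
    (M : Matrix (A × B) (A × B) ℂ) :
    traceLeft ((W ⊗ₖ V) * M * (W ⊗ₖ V).conjTranspose) = V * traceLeft M * V.conjTranspose := by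
  have h1 : W ⊗ₖ V = ((1 : Matrix A A ℂ) ⊗ₖ V) * (W ⊗ₖ (1 : Matrix B B ℂ)) := by
    rw [← Matrix.mul_kronecker_mul, Matrix.one_mul, Matrix.mul_one]
  have h2 : (W ⊗ₖ V).conjTranspose =
      (W.conjTranspose ⊗ₖ (1 : Matrix B B ℂ)) * ((1 : Matrix A A ℂ) ⊗ₖ V.conjTranspose) := by
    rw [← Matrix.mul_kronecker_mul, Matrix.one_mul, Matrix.mul_one, Matrix.conjTranspose_kronecker]
  rw [h2, ← Matrix.mul_assoc, traceLeft_mul_one_kronecker, h1, Matrix.mul_assoc, Matrix.mul_assoc,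
    traceLeft_one_kronecker_mul, traceLeft_kronecker_one_mul_comm, Matrix.mul_assoc M,
    ← Matrix.mul_kronecker_mul, ← Matrix.star_eq_conjTranspose W,
    Matrix.mem_unitaryGroup_iff'.1 hW, Matrix.mul_one, Matrix.one_kronecker_one, Matrix.mul_one]

/-- Erasure turns a product unitary into the product unitary on the remaining subsystems. -/
theorem erasure_piTensor_conj [∀ i, Fintype (P i)] [∀ i, DecidableEq (P i)] (S : Finset (Fin n))
    {V : ∀ i, Matrix (P i) (P i) ℂ} (hV : ∀ i, V i ∈ Matrix.unitaryGroup (P i) ℂ)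
    (M : Matrix (∀ i, P i) (∀ i, P i) ℂ) :
    erasure S (piTensor V * M * (piTensor V).conjTranspose) =
      conjMap (prodTensor fun i : {i // ¬ i ∈ S} => V i) (erasure S M) := by
  have hW : prodTensor (fun i : {i // i ∈ S} => V i) ∈
      Matrix.unitaryGroup (∀ i : {i // i ∈ S}, P i) ℂ := prodTensor_mem_unitaryGroup fun i => hV i
  let e := (Equiv.piEquivPiSubtypeProd (fun i => i ∈ S) P).symm
  have her : ∀ X, erasure S X = traceLeft (X.submatrix e e) := fun X => rfl
  have hpi : (piTensor V).submatrix e e = prodTensor (fun i : {i // i ∈ S} => V i) ⊗ₖ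
      prodTensor (fun i : {i // ¬ i ∈ S} => V i) := by
    ext x y
    exact piTensor_symm_apply S V x y
  rw [her, her, ← Matrix.submatrix_mul_equiv _ _ e e e, ← Matrix.submatrix_mul_equiv _ _ e e e,
    ← Matrix.conjTranspose_submatrix, hpi,
    traceLeft_kronecker_conj hW, conjMap_apply]

end Erasure

/-! ### From worst-case fidelity to min-entropy -/

section Correctability

variable {L Q : Type*}

theorem choiState_apply [Fintype L] [DecidableEq L] (N : Matrix L L ℂ →ₗ[ℂ] Matrix Q Q ℂ)
    (x y : L × Q) :
    choiState N x y = (Fintype.card L : ℂ)⁻¹ * N (Matrix.single x.1 y.1 1) x.2 y.2 := by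
  rw [choiState, Matrix.smul_apply, idTensor_maxEntangled, smul_eq_mul]

theorem posSemidef_choiState [Fintype L] [DecidableEq L] [Fintype Q]
    {N : Matrix L L ℂ →ₗ[ℂ] Matrix Q Q ℂ} (hN : IsChannel N) : (choiState N).PosSemidef :=
  (hN.1.posSemidef_idTensor posSemidef_maxEntangled).smul (by
    rw [← Complex.ofReal_natCast, ← Complex.ofReal_inv]
    exact_mod_cast (inv_nonneg.2 (Nat.cast_nonneg (α := ℝ) (Fintype.card L))))

/-- Both sides are `d²` times the entanglement fidelity of the recovered code when `choiMap Y` is a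
channel; this links the trace formula to the semidefinite program. -/
theorem trace_superMatrix_choiMap_comp [Fintype L] [DecidableEq L] [Nonempty L] [Fintype Q]
    (N : Matrix L L ℂ →ₗ[ℂ] Matrix Q Q ℂ) (Y : Matrix (L × Q) (L × Q) ℂ) :
    (superMatrix (choiMap Y ∘ₗ N)).trace = Fintype.card L * pairing (choiState N) Y := by
  have hd : (Fintype.card L : ℂ) ≠ 0 := by exact_mod_cast Fintype.card_ne_zero
  simp only [pairing, choiState_apply, Matrix.trace, Matrix.diag_apply, superMatrix, Matrix.of_apply,
    LinearMap.comp_apply, choiMap_apply, Fintype.sum_prod_type, Finset.mul_sum]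
  refine Finset.sum_congr rfl fun a _ => ?_
  rw [Finset.sum_comm]
  refine Finset.sum_congr rfl fun q _ => Finset.sum_congr rfl fun b _ =>
    Finset.sum_congr rfl fun q' _ => ?_
  field_simp

theorem fidelity_apply_pure [Fintype L] [DecidableEq L] {T : Matrix L L ℂ →ₗ[ℂ] Matrix L L ℂ}
    (hT : IsChannel T) (v : L → ℂ) :
    fidelity (T (Matrix.vecMulVec v (star v))) (Matrix.vecMulVec v (star v)) = (overlap T v).re :=
  fidelity_pure (hT.1.posSemidef_apply (Matrix.posSemidef_vecMulVec_self_star v)) v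

/-- For a covariant noise, the optimal worst-case fidelity and the optimal entanglement fidelity of
recovery determine each other. -/
theorem exists_overlap_iff_exists_pairing [Fintype L] [DecidableEq L] [Nonempty L] [Fintype Q]
    [DecidableEq Q] {N : Matrix L L ℂ →ₗ[ℂ] Matrix Q Q ℂ} (hN : IsChannel N)
    (hcov : ∀ U ∈ Matrix.unitaryGroup L ℂ, ∃ V ∈ Matrix.unitaryGroup Q ℂ,
      N ∘ₗ conjMap U = conjMap V ∘ₗ N)
    {ε c : ℝ} (hc : c = ((Fintype.card L : ℝ) + 1) / (Fintype.card L : ℝ)) :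
    (∃ D : Matrix Q Q ℂ →ₗ[ℂ] Matrix L L ℂ, IsChannel D ∧
      ∀ v : L → ℂ, star v ⬝ᵥ v = 1 → 1 - ε ≤ (overlap (D ∘ₗ N) v).re) ↔
    ∃ Y ∈ channelChoi L Q, Fintype.card L * (1 - c * ε) ≤ (pairing (choiState N) Y).re := by
  let i := Classical.arbitrary L
  set d : ℝ := (Fintype.card L : ℝ) with hd
  have hd0 : 0 < d := by rw [hd]; exact_mod_cast Fintype.card_pos
  have hcd : c * d = d + 1 := by rw [hc]; field_simp
  have key : ∀ D : Matrix Q Q ℂ →ₗ[ℂ] Matrix L L ℂ, IsChannel D →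
      (∀ U ∈ Matrix.unitaryGroup L ℂ, twist U (D ∘ₗ N) = D ∘ₗ N) →
      1 + (pairing (choiState N) (choiMatrix D)).re
        = (overlap (D ∘ₗ N) (Pi.single i 1)).re * (d + 1) := by
    intro D hD hT
    have h := card_add_trace_superMatrix (hD.comp hN).2 hT i
    have h2 := trace_superMatrix_choiMap_comp N (choiMatrix D)
    rw [choiMap_choiMatrix] at h2
    rw [h2] at h
    have h3 := congrArg Complex.re h
    have h4 : ((Fintype.card L : ℂ) * (Fintype.card L + 1)) = ((d * (d + 1) : ℝ) : ℂ) := by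
      simp [hd]
    have h5 : (Fintype.card L : ℂ) = ((d : ℝ) : ℂ) := by simp [hd]
    rw [h4, Complex.re_mul_ofReal, h5, Complex.add_re, Complex.re_ofReal_mul,
      Complex.ofReal_re] at h3
    refine mul_left_cancel₀ hd0.ne' ?_
    linarith
  -- The value of `c` enters here: `d (1 - c ε) = (1 - ε) (d + 1) - 1`.
  have hequiv : ∀ F p : ℝ, 1 + p = F * (d + 1) → (1 - ε ≤ F ↔ d * (1 - c * ε) ≤ p) := by
    intro F p h
    have h1 : d * (1 - c * ε) = (1 - ε) * (d + 1) - 1 := by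
      linear_combination (-ε) * hcd
    rw [h1, ← mul_le_mul_iff_left₀ (show 0 < d + 1 by linarith)]
    constructor <;> intro h' <;> linarith
  constructor
  · intro h
    obtain ⟨D, hD, hp, hT⟩ := exists_covariant hcov
      (fun T => ∀ v : L → ℂ, star v ⬝ᵥ v = 1 → 1 - ε ≤ (overlap T v).re) (by
        simp only [Set.ofPred_forall]
        refine isClosed_iInter fun v => isClosed_iInter fun _ =>
          isClosed_le continuous_const (Complex.continuous_re.comp ?_)
        exact continuous_const.dotProduct
          ((continuous_choiMap_apply (N (Matrix.vecMulVec v (star v)))).matrix_mulVec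
            continuous_const)) (by
        intro T T' h h' v hv
        have : overlap ((2⁻¹ : ℂ) • (T + T')) v = ((2⁻¹ : ℝ) : ℂ) * (overlap T v + overlap T' v) := by
          simp [overlap, Matrix.smul_mulVec, Matrix.add_mulVec, mul_add]
        rw [this, Complex.re_ofReal_mul, Complex.add_re]
        linarith [h v hv, h' v hv]) (by
        intro U hU T h v hv
        rw [← overlap_mulVec]
        refine h _ ?_
        rw [Matrix.star_mulVec, ← Matrix.dotProduct_mulVec, Matrix.mulVec_mulVec,
          ← Matrix.star_eq_conjTranspose, Matrix.mem_unitaryGroup_iff'.1 hU, Matrix.one_mulVec, hv])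
      h
    exact ⟨choiMatrix D, hD.choiMatrix_mem, (hequiv _ _ (key D hD hT)).1 (hp _ (by simp))⟩
  · rintro ⟨Y, hY, hle⟩
    -- The twirled condition is now on the trace, which twisting leaves unchanged. The additional
    -- factor `d` is the ratio of trace to pairing.
    obtain ⟨D, hD, hp, hT⟩ := exists_covariant hcov
      (fun T => d * (d * (1 - c * ε)) ≤ (superMatrix T).trace.re) (by
        refine isClosed_le continuous_const (Complex.continuous_re.comp ?_)
        exact continuous_finsetSum _ fun x _ =>
          (continuous_choiMap_apply _).matrix_elem x.1 x.2) (by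
        intro T T' h h'
        have : (superMatrix ((2⁻¹ : ℂ) • (T + T'))).trace
            = ((2⁻¹ : ℝ) : ℂ) * ((superMatrix T).trace + (superMatrix T').trace) := by
          simp [superMatrix, Matrix.trace, ← Finset.sum_add_distrib, Finset.mul_sum, mul_add]
        rw [this, Complex.re_ofReal_mul, Complex.add_re]
        linarith) (by
        intro U hU T h
        rwa [trace_superMatrix_twist hU])
      ⟨choiMap Y, isChannel_choiMap hY, by
        rw [trace_superMatrix_choiMap_comp, ← Complex.ofReal_natCast, Complex.re_ofReal_mul]
        exact mul_le_mul_of_nonneg_left hle hd0.le⟩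
    refine ⟨D, hD, fun v hv => ?_⟩
    rw [overlap_eq_of_covariant hT i, hv, one_pow, one_mul]
    refine (hequiv _ _ (key D hD hT)).2 ?_
    have h2 := trace_superMatrix_choiMap_comp N (choiMatrix D)
    rw [choiMap_choiMatrix] at h2
    rw [h2, ← Complex.ofReal_natCast, Complex.re_ofReal_mul] at hp
    exact le_of_mul_le_mul_left hp hd0

/-- A channel reaching the value `f` exists iff the conditional min-entropy is at most `-log f`. -/
theorem exists_pairing_iff_condMinEntropy_le [Fintype L] [DecidableEq L] [Nonempty L] [Fintype Q]
    [DecidableEq Q] [Nonempty Q] {Ω : Matrix (L × Q) (L × Q) ℂ} (hΩ : Ω.PosSemidef) (f : ℝ) :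
    (∃ Y ∈ channelChoi L Q, f ≤ (pairing Ω Y).re) ↔ condMinEntropy Ω ≤ - log₂ f := by
  set T : Set ℝ := {t : ℝ | ∃ X : Matrix Q Q ℂ, X.PosSemidef ∧
      ((1 : Matrix L L ℂ) ⊗ₖ X - Ω).PosSemidef ∧ t = X.trace.re} with hT
  have hbdd : BddBelow T := ⟨0, by
    rintro _ ⟨X, hX, -, rfl⟩
    exact (Complex.nonneg_iff.1 hX.trace_nonneg).1⟩
  -- Strong duality, applied above an upper bound of the primal values, supplies a feasible point;
  -- `sInf ∅ = 0` would make the entropy meaningless.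
  have hne : T.Nonempty := by
    obtain ⟨C, hC⟩ := (isCompact_channelChoi L Q).bddAbove_image
      (f := fun Y => (pairing Ω Y).re) (Complex.continuous_re.comp (continuous_pairing Ω)).continuousOn
    obtain ⟨X, h1, h2, -⟩ := exists_dual_lt hΩ (f := C + 1) fun Y hY =>
      (hC ⟨Y, hY, rfl⟩).trans_lt (lt_add_one C)
    exact ⟨_, X, h1, h2, rfl⟩
  rw [condMinEntropy, EReal.neg_le_neg_iff]
  constructor
  · rintro ⟨Y, hY, hle⟩
    have h : f ≤ sInf T := le_csInf hne (by
      rintro _ ⟨X, -, hX, rfl⟩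
      exact hle.trans (pairing_le_of_dual_feasible hY hX))
    by_cases hf : 0 < f
    · rw [log₂, log₂, if_pos hf, if_pos (hf.trans_le h)]
      exact_mod_cast Real.logb_le_logb_of_le one_lt_two hf h
    · rw [log₂, if_neg hf]
      exact bot_le
  · intro h
    -- If every channel stays below `f`, duality gives a feasible trace in `[0, f)`. Then `f > 0`,
    -- so its logarithm is finite and strict monotonicity, or the value `⊥` for a nonpositive
    -- infimum, gives the contradiction.
    by_contra! hcon
    obtain ⟨X, h1, h2, h3⟩ := exists_dual_lt hΩ hcon
    have h4 : 0 ≤ X.trace.re := (Complex.nonneg_iff.1 h1.trace_nonneg).1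
    have hf : 0 < f := h4.trans_lt h3
    have h5 : sInf T ≤ X.trace.re := csInf_le hbdd ⟨X, h1, h2, rfl⟩
    rw [log₂, log₂, if_pos hf] at h
    split_ifs at h with hp
    · have h6 : Real.logb 2 f ≤ Real.logb 2 (sInf T) := by exact_mod_cast h
      have h7 := (Real.logb_le_logb one_lt_two hf hp).1 h6
      linarith
    · exact absurd (le_bot_iff.1 h) (EReal.coe_ne_bot _)

theorem isCorrectable_iff_exists_overlap {P : Type*} [Fintype L] [DecidableEq L] [Fintype P]
    [Fintype Q]
    {E : Matrix L L ℂ →ₗ[ℂ] Matrix P P ℂ} {N : Matrix P P ℂ →ₗ[ℂ] Matrix Q Q ℂ}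
    (hEN : IsChannel (N ∘ₗ E)) (ε : ℝ) :
    IsCorrectable E N ε ↔ ∃ D : Matrix Q Q ℂ →ₗ[ℂ] Matrix L L ℂ, IsChannel D ∧
      ∀ v : L → ℂ, star v ⬝ᵥ v = 1 → 1 - ε ≤ (overlap (D ∘ₗ N ∘ₗ E) v).re := by
  refine exists_congr fun D => and_congr_right fun hD => ?_
  constructor
  · intro h v hv
    rw [← fidelity_apply_pure (hD.comp hEN)]
    exact h _ ⟨v, hv, rfl⟩
  · rintro h _ ⟨v, hv, rfl⟩
    exact (h v hv).trans_eq (fidelity_apply_pure (hD.comp hEN) v).symm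

theorem isCorrectable_iff_condMinEntropy_le {P : Type*} [Fintype L] [DecidableEq L] [Nonempty L]
    [Fintype P] [Fintype Q] [DecidableEq Q]
    {E : Matrix L L ℂ →ₗ[ℂ] Matrix P P ℂ} {N : Matrix P P ℂ →ₗ[ℂ] Matrix Q Q ℂ}
    (hEN : IsChannel (N ∘ₗ E))
    (hcov : ∀ U ∈ Matrix.unitaryGroup L ℂ, ∃ V ∈ Matrix.unitaryGroup Q ℂ,
      (N ∘ₗ E) ∘ₗ conjMap U = conjMap V ∘ₗ (N ∘ₗ E))
    {ε c : ℝ} (hc : c = ((Fintype.card L : ℝ) + 1) / (Fintype.card L : ℝ)) :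
    IsCorrectable E N ε ↔
      condMinEntropy (choiState (N ∘ₗ E)) ≤ - log₂ ((Fintype.card L : ℝ) * (1 - c * ε)) := by
  -- On an empty index type all traces vanish, but trace preservation sends `1` to trace `d ≠ 0`.
  have : Nonempty Q := by
    by_contra hQ
    rw [not_nonempty_iff] at hQ
    have h := hEN.2 1
    rw [Matrix.trace_one, Matrix.trace, Finset.univ_eq_empty, Finset.sum_empty] at h
    exact Fintype.card_ne_zero (α := L) (by exact_mod_cast h.symm)
  rw [isCorrectable_iff_exists_overlap hEN, exists_overlap_iff_exists_pairing hEN hcov hc,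
    exists_pairing_iff_condMinEntropy_le (posSemidef_choiState hEN)]

end Correctability

end QCode

theorem corollary1 {n : ℕ} {L : Type*} {P : Fin n → Type*}
    [Fintype L] [DecidableEq L] [Nonempty L]
    [∀ i, Fintype (P i)] [∀ i, DecidableEq (P i)]
    (E : Matrix L L ℂ →ₗ[ℂ] Matrix (∀ i, P i) (∀ i, P i) ℂ)
    (hE : QCode.IsChannel E)
    (htrans : ∀ U ∈ Matrix.unitaryGroup L ℂ, QCode.IsTransversalGate E U)
    (ε c : ℝ) (hc : c = ((Fintype.card L : ℝ) + 1) / (Fintype.card L : ℝ)) :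
    (∀ j : Fin n,
      (QCode.IsCorrectable E (QCode.erasure {j}) ε ↔
        QCode.condMinEntropy (QCode.choiState (QCode.erasure {j} ∘ₗ E))
          ≤ - QCode.log₂ ((Fintype.card L : ℝ) * (1 - c * ε)))) ∧
    (∀ S : Finset (Fin n), S.card < n →
      (QCode.IsCorrectable E (QCode.erasure S) ε ↔
        QCode.condMinEntropy (QCode.choiState (QCode.erasure S ∘ₗ E))
          ≤ - QCode.log₂ ((Fintype.card L : ℝ) * (1 - c * ε)))) := by
  have main : ∀ S : Finset (Fin n), (QCode.IsCorrectable E (QCode.erasure S) ε ↔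
        QCode.condMinEntropy (QCode.choiState (QCode.erasure S ∘ₗ E))
          ≤ - QCode.log₂ ((Fintype.card L : ℝ) * (1 - c * ε))) := by
    intro S
    refine QCode.isCorrectable_iff_condMinEntropy_le ((QCode.isChannel_erasure S).comp hE) ?_ hc
    intro U hU
    obtain ⟨V, hV, hEV⟩ := htrans U hU
    refine ⟨QCode.prodTensor fun i : {i // ¬ i ∈ S} => V i,
      QCode.prodTensor_mem_unitaryGroup fun i => hV i, LinearMap.ext fun X => ?_⟩
    simp only [LinearMap.comp_apply]
    rw [← QCode.erasure_piTensor_conj S hV, ← hEV, QCode.conjMap_apply]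
  exact ⟨fun j => main {j}, fun S _ => main S⟩
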